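/- **Sets of values.** For a rational number $x=p/q$ in reduced form ($q\ge 1$), let $\bar e(x)$ be the largest power of $2$ that divides $q$. For $n\ge 0$ let $R_n=\{x\in\mathbb{Q} : 0\le x\le 1,\ \bar e(x)=2^n\}$ and $R_{\le n}=R_0\cup R_1\cup\dots\cup R_n$. **Problem.** A maximal fractional matching of a finite graph $G=(V,E)$ is a function $x\colon E\to[0,1]$ such that, with $x[v]=\sum_{e\in E:\,v\in e}x(e)$, we have $x[v]\le 1$ for every $v\in V$, and $x[u]=1$ or $x[v]=1$ for every edge $\{u,v\}\in E$. **Model.** In the (deterministic) LOCAL model every node of the input graph $G$ with $n$ nodes is a computer and every edge is a communication link. A node of degree $k$ refers to its incident edges by port numbers $1,\dots,k$, chosen by an adversary. The nodes carry pairwise distinct identifiers from $\{1,\dots,n^c\}$, also chosen by an adversary, where $c\ge 1$ is a fixed integer. Initially a node knows only its degree, its identifier and $n$. In each synchronous round every node sends an arbitrary message through each of its ports, receives a message through each of its ports, and updates its state; the messages, the states and the local computations are unrestricted. A node may at any time (also before the first round) stop and announce a value for each of its incident edges. The algorithm solves the problem in $T$ rounds on $G$ if, for all port numberings and all identifier assignments,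 after $T$ rounds all nodes have stopped, the two endpoints of each edge have announced the same value for it, and these values form a maximal fractional matching. **Lemma.** Let $d\ge 1$, $c\ge 1$ and $T\ge 0$ be integers. There is no algorithm in the LOCAL model (with identifiers from $\{1,\dots,n^c\}$) that, in $T$ rounds, computes a maximal fractional matching with all values in $R_{\le d-1}$ on every finite tree of maximum degree at most $2d$. (The algorithm may depend on $d$, $c$ and $T$.) -/

import Mathlib

universe u v

/-! ### Sets of rational numbers -/

/-- The even part `e(x)` of a natural number: if `x = 2 ^ n * m` with `m` odd then `e(x) = 2 ^ n`,
and `e(0) = 0`. -/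
def evenPart (x : ℕ) : ℕ := if x = 0 then 0 else 2 ^ padicValNat 2 x

/-- `R n`: the rationals in `[0, 1]` whose reduced denominator has even part `2 ^ n`. -/
def R (n : ℕ) : Set ℚ := {x | 0 ≤ x ∧ x ≤ 1 ∧ evenPart x.den = 2 ^ n}

/-- `R_{≤ n} = R_0 ∪ R_1 ∪ ⋯ ∪ R_n`. -/
def RLe (n : ℕ) : Set ℚ := {x | ∃ i ≤ n, x ∈ R i}

/-! ### Maximal fractional matchings -/

/-- `x[v]`: the sum of the values of the edges incident to `v`. -/
def nodeSum {V : Type} [Fintype V] [DecidableEq V] (G : SimpleGraph V) [DecidableRel G.Adj]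
    (x : Sym2 V → ℚ) (v : V) : ℚ :=
  ∑ e ∈ G.incidenceFinset v, x e

/-- `x` (only its values on the edges of `G` matter) is a maximal fractional matching of `G`. -/
structure IsMaximalFractionalMatching {V : Type} [Fintype V] [DecidableEq V] (G : SimpleGraph V)
    [DecidableRel G.Adj] (x : Sym2 V → ℚ) : Prop where
  mem_unitInterval : ∀ e ∈ G.edgeSet, 0 ≤ x e ∧ x e ≤ 1
  nodeSum_le_one : ∀ v, nodeSum G x v ≤ 1
  saturated : ∀ a b, G.Adj a b → nodeSum G x a = 1 ∨ nodeSum G x b = 1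

/-! ### The LOCAL model -/

/-- A port numbering: at every node `v` a numbering of the edges incident to `v`
(each given by its other endpoint) by `0, …, deg v - 1`. -/
abbrev PortNumbering {V : Type} [Fintype V] (G : SimpleGraph V) [DecidableRel G.Adj] : Type :=
  ∀ v : V, Fin (G.degree v) ≃ G.neighborSet v

/-- A deterministic algorithm in the LOCAL model whose task is to assign a rational number to every
edge. The states, the messages and the local computations are arbitrary. In every function the
argument `deg` is the degree of the node that carries out the step. -/
structure LocalAlgorithm where
  /-- local states of a node -/
  State : Type u
  /-- messages -/
  Msg : Type v
  /-- initial state, from the number of nodes, the identifier and the degree of the node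
  (algorithms that do not know the number of nodes are those ignoring the first argument) -/
  init : (n ident deg : ℕ) → State
  /-- the message sent through each port -/
  send : (deg : ℕ) → State → Fin deg → Msg
  /-- the new state, from the old state and the message received through each port -/
  update : (deg : ℕ) → State → (Fin deg → Msg) → State
  /-- `none` as long as the node is running; `some y` if it has stopped and announced the value
  `y i` for the edge at each port `i` -/
  output : (deg : ℕ) → State → Option (Fin deg → ℚ)

namespace LocalAlgorithm

/-- The state of each node after `t` synchronous rounds. In a round, the node `v` receives through
its port `i`, which leads to the neighbour `w`, the message that `w` sends through the port of `w`
that leads to `v`. A node that has stopped keeps its state. -/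
def stateAt (A : LocalAlgorithm.{u, v}) {V : Type} [Fintype V] (G : SimpleGraph V)
    [DecidableRel G.Adj] (P : PortNumbering G) (ident : V → ℕ) : ℕ → V → A.State
  | 0, a => A.init (Fintype.card V) (ident a) (G.degree a)
  | t + 1, a =>
    match A.output (G.degree a) (A.stateAt G P ident t a) with
    | some _ => A.stateAt G P ident t a
    | none => A.update (G.degree a) (A.stateAt G P ident t a) fun i =>
        let w : G.neighborSet a := P a i
        A.send (G.degree w.1) (A.stateAt G P ident t w.1) ((P w.1).symm ⟨a, G.adj_symm w.2⟩)

/-- After `T` rounds all nodes have stopped, the two endpoints of every edge have announced the same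
value for it, and these values lie in `S` and form a maximal fractional matching. -/
def SolvesOn (A : LocalAlgorithm.{u, v}) (T : ℕ) (S : Set ℚ) {V : Type} [Fintype V] [DecidableEq V]
    (G : SimpleGraph V) [DecidableRel G.Adj] (P : PortNumbering G) (ident : V → ℕ) : Prop :=
  ∃ x : Sym2 V → ℚ,
    (∀ a, A.output (G.degree a) (A.stateAt G P ident T a) = some fun i => x s(a, (P a i).1)) ∧
    (∀ e ∈ G.edgeSet, x e ∈ S) ∧
    IsMaximalFractionalMatching G x

/-- In `T` rounds, `A` finds a maximal fractional matching with values in `S` on every finite tree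
of maximum degree at most `Δ`, for all port numberings and all assignments of unique identifiers
from `{1, …, n ^ c}`, where `n` is the number of nodes. -/
def SolvesOnTrees (A : LocalAlgorithm.{u, v}) (T c Δ : ℕ) (S : Set ℚ) : Prop :=
  ∀ (V : Type) [Fintype V] [DecidableEq V] (G : SimpleGraph V) [DecidableRel G.Adj],
    G.IsTree → G.maxDegree ≤ Δ →
    ∀ (P : PortNumbering G) (ident : V → ℕ), Function.Injective ident →
      (∀ a, 1 ≤ ident a ∧ ident a ≤ Fintype.card V ^ c) →
      A.SolvesOn T S G P ident

end LocalAlgorithm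

/-!
The proof compares the values of an algorithm on finite trees that look alike near some nodes.

**Trees and symmetry.** All trees are finite subtrees of the Cayley tree of the free group on `d`
generators, which is `2 * d`-regular. A labelled graph, whose edges are directed and labelled by
the generators and may be loops, has a universal cover at each node, which is a subtree of the
Cayley tree. An algorithm that depends only on the shape of the neighbourhood of a node therefore
also assigns values to the edges of a labelled graph.

**Identifiers.** To remove the influence of the identifiers, they are chosen generically. The free
group has a left-invariant linear order (`heightLE`). The nodes of a finite region receive their
identifiers one after the other in this order, each chosen generically with respect to a
nonprincipal ultrafilter on `ℕ`, and last the number of nodes is chosen generically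
(`genericIds`). What a node then computes depends only on its neighbourhood, up to translation
(`LocalAlgorithm.eventually_colour_eq`); this takes the place of Ramsey's theorem. The values may be
arbitrary rationals, so only finitely many possibilities are recorded: the residue of
`2 ^ (d - 1) * x` modulo `2 ^ d` for each announced value `x`, and whether the node is saturated. The
prescribed number of nodes is reached by enlarging the finite tree far away from the region
(`IsRootedSubtree.exists_finite`). Hence the generic colours satisfy the constraints of a maximal
fractional matching (`LocalAlgorithm.genericColour_spec`).

**Divisibility.** A node with a loop is saturated, since its two neighbouring lifts have the same
colour. Consider a finite labelled graph with a loop at each node in which all edges other than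
loops are bridges. Summing the values around the nodes on one side of a bridge counts all
other edges an even number of times, so if all residues are divisible by `2 ^ k` with `k + 1 < d`,
those of the bridges are divisible by `2 ^ (k + 1)` (`LocalAlgorithm.two_pow_succ_dvd_of_isCut`). A
loop can be turned into a bridge by unfolding it to a long path of copies of the graph, which
does not change what the algorithm sees near the middle. By induction, all residues are divisible by
`2 ^ k` if each node has at least `k + 1` loops (`LocalAlgorithm.two_pow_dvd_nodeColour`). For one
node with `d` loops this means that all residues are divisible by `2 ^ (d - 1)`. Each loop counts
twice at the node, so the sum around it is `0` modulo `2 ^ d`, but saturation says that it is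
`2 ^ (d - 1)`.
-/

/-! ### A left-invariant order on the free group -/

section Words

variable {α : Type}

/-- The inverse of a letter of the alphabet `α × Bool` of a free group. -/
def invLetter (x : α × Bool) : α × Bool := (x.1, !x.2)

@[simp] lemma invLetter_invLetter (x : α × Bool) : invLetter (invLetter x) = x := by
  simp [invLetter]

/-- `+1` or `-1` for a positive or a negative letter. -/
def letterSign (x : α × Bool) : ℤ := if x.2 then 1 else -1

lemma letterSign_invLetter (x : α × Bool) : letterSign (invLetter x) = -letterSign x := by
  rcases x with ⟨a, b⟩
  cases b <;> simp [letterSign, invLetter]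

lemma odd_letterSign (x : α × Bool) : Odd (letterSign x) := by
  rcases x with ⟨a, b⟩
  cases b <;> simp [letterSign]

lemma isReduced_cons_iff {x : α × Bool} {l : List (α × Bool)} :
    FreeGroup.IsReduced (x :: l) ↔ l.head? ≠ some (invLetter x) ∧ FreeGroup.IsReduced l := by
  rcases l with _ | ⟨y, l⟩
  · simp
  · rw [FreeGroup.isReduced_cons_cons]
    have : (x.1 = y.1 → x.2 = y.2) ↔ y ≠ invLetter x := by
      rcases x with ⟨a, b⟩; rcases y with ⟨a', b'⟩
      simp only [invLetter, ne_eq, Prod.mk.injEq, not_and]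
      constructor
      · rintro h rfl; rw [h rfl]; cases b' <;> simp
      · rintro h rfl; have := h rfl; revert this; cases b <;> cases b' <;> simp
    simp [this]

lemma isReduced_append_iff {l m : List (α × Bool)} :
    FreeGroup.IsReduced (l ++ m) ↔ FreeGroup.IsReduced l ∧ FreeGroup.IsReduced m ∧
      ∀ x ∈ l.getLast?, m.head? ≠ some (invLetter x) := by
  induction l with
  | nil => simp
  | cons x l ih =>
    rw [List.cons_append, isReduced_cons_iff, isReduced_cons_iff, ih]
    rcases l with _ | ⟨y, l⟩
    · simp; tauto
    · simp; tauto

lemma head?_invRev (l : List (α × Bool)) :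
    (FreeGroup.invRev l).head? = l.getLast?.map invLetter := by
  simp [FreeGroup.invRev, List.head?_reverse, List.getLast?_map]
  rfl

lemma getLast?_invRev (l : List (α × Bool)) :
    (FreeGroup.invRev l).getLast?.map invLetter = l.head? := by
  rw [← head?_invRev, FreeGroup.invRev_invRev]

end Words

section FreeGroupOrder

variable {α : Type} [LinearOrder α]

/-- The comparison of two letters in the lexicographic order: `1` if `x < y`, `-1` if `y < x`,
`0` if they are equal or if one of them is missing. -/
def side : Option (α × Bool) → Option (α × Bool) → ℤ
  | some x, some y => if toLex x < toLex y then 1 else if toLex y < toLex x then -1 else 0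
  | _, _ => 0

@[simp] lemma side_none_left (y : Option (α × Bool)) : side none y = 0 := by
  cases y <;> rfl

@[simp] lemma side_none_right (x : Option (α × Bool)) : side x none = 0 := by
  cases x <;> rfl

lemma side_swap (x y : Option (α × Bool)) : side x y = -side y x := by
  rcases x with _ | x <;> rcases y with _ | y <;> simp only [side, neg_zero]
  rcases lt_trichotomy (toLex x) (toLex y) with h | h | h
  · simp [h, h.not_gt]
  · simp [h]
  · simp [h, h.not_gt]

lemma odd_side {x y : α × Bool} (h : x ≠ y) : Odd (side (some x) (some y)) := by
  simp only [side]
  rcases lt_trichotomy (toLex x) (toLex y) with h' | h' | h'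
  · simp [h']
  · exact absurd (toLex.injective h') h
  · simp [h', h'.not_gt]

/-- The three turns at the branching vertex of a tripod do not all have the same direction. -/
lemma side_add_side_le (x y z : Option (α × Bool)) : side x y + side y z ≤ side x z + 1 := by
  rcases x with _ | x
  · rcases y with _ | y <;> rcases z with _ | z <;> simp only [side]
    all_goals (try split_ifs) <;> norm_num
  rcases y with _ | y
  · rcases z with _ | z <;> simp only [side]
    all_goals (try split_ifs) <;> norm_num
  rcases z with _ | z
  · simp only [side]
    split_ifs <;> norm_num
  simp only [side]
  generalize toLex x = x, toLex y = y, toLex z = z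
  split_ifs
  all_goals first
    | norm_num; done
    | (exfalso; order)

/-- The height of a word, read as a walk in the Cayley tree: every edge contributes the sign of its
letter, and every interior vertex contributes `1` or `-1` according to whether the direction from
which the walk enters is smaller or larger than the direction in which it leaves. -/
def height : List (α × Bool) → ℤ
  | [] => 0
  | x :: l => letterSign x + side (some (invLetter x)) l.head? + height l

lemma height_append (l m : List (α × Bool)) :
    height (l ++ m) = height l + height m + side (l.getLast?.map invLetter) m.head? := by
  induction l with
  | nil => simp [height]
  | cons x l ih =>
    rcases l with _ | ⟨y, l⟩
    · simp [height]; ring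
    · rw [List.cons_append, height, ih, height.eq_2 x]
      simp; ring

lemma height_invRev (l : List (α × Bool)) : height (FreeGroup.invRev l) = -height l := by
  induction l with
  | nil => simp [height]
  | cons x l ih =>
    rw [FreeGroup.invRev_cons, height_append, ih, getLast?_invRev, height]
    have h1 : FreeGroup.invRev [x] = [invLetter x] := by simp [FreeGroup.invRev, invLetter]
    rw [h1, side_swap]
    simp [height, letterSign_invLetter]; ring

/-- A nonempty reduced word has one more edge than interior vertices, and each edge and each interior
vertex contributes an odd number. In particular, its height is not zero. -/
lemma odd_height {l : List (α × Bool)} (hl : FreeGroup.IsReduced l) (h0 : l ≠ []) :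
    Odd (height l) := by
  induction l with
  | nil => exact absurd rfl h0
  | cons x l ih =>
    rw [isReduced_cons_iff] at hl
    rcases l with _ | ⟨y, l⟩
    · simpa [height] using odd_letterSign x
    · rw [height]
      have h1 : y ≠ invLetter x := by simpa using hl.1
      exact ((odd_letterSign x).add_odd (odd_side h1.symm)).add_odd (ih hl.2 (by simp))

/-- The cancellation in a product of two reduced words. -/
lemma exists_cancellation (l m : List (α × Bool)) (hl : FreeGroup.IsReduced l)
    (hm : FreeGroup.IsReduced m) : ∃ a c b, l = a ++ c ∧ m = FreeGroup.invRev c ++ b ∧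
      FreeGroup.IsReduced (a ++ b) := by
  induction l using List.reverseRecOn generalizing m with
  | nil => exact ⟨[], [], m, rfl, rfl, by simpa using hm⟩
  | append_singleton l x ih =>
    by_cases h : m.head? = some (invLetter x)
    · rcases m with _ | ⟨y, m⟩
      · simp at h
      · obtain rfl : y = invLetter x := by simpa using h
        obtain ⟨a, c, b, rfl, rfl, hr⟩ := ih m (isReduced_append_iff.1 hl).1
          (isReduced_cons_iff.1 hm).2
        refine ⟨a, c ++ [x], b, by simp, ?_, hr⟩
        simp [FreeGroup.invRev, invLetter]
    · refine ⟨l ++ [x], [], m, by simp, by simp, isReduced_append_iff.2 ⟨hl, hm, ?_⟩⟩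
      simpa using h

/-- Heights are superadditive up to an error of one, the turn at the branching vertex of the tripod
spanned by `1`, `g` and `g * h`. -/
lemma height_mul_ge (g h : FreeGroup α) :
    height g.toWord + height h.toWord - 1 ≤ height (g * h).toWord := by
  obtain ⟨a, c, b, h1, h2, hr⟩ := exists_cancellation g.toWord h.toWord
    FreeGroup.isReduced_toWord FreeGroup.isReduced_toWord
  have h3 : (g * h).toWord = a ++ b := by
    have : g * h = FreeGroup.mk (a ++ b) := by
      rw [← FreeGroup.mk_toWord (x := g), ← FreeGroup.mk_toWord (x := h), h1, h2]
      rw [← FreeGroup.mul_mk, ← FreeGroup.mul_mk, ← FreeGroup.mul_mk, ← FreeGroup.inv_mk]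
      group
    rw [this, FreeGroup.toWord_mk, hr.reduce_eq]
  rw [h1, h2, h3, height_append, height_append, height_append, height_invRev, getLast?_invRev]
  have := side_add_side_le (a.getLast?.map invLetter) c.head? b.head?
  linarith

/-- The order on the free group: `g ≤ h` if the geodesic from `g` to `h` in the Cayley tree has
nonnegative height. -/
def heightLE (g h : FreeGroup α) : Prop := 0 ≤ height (g⁻¹ * h).toWord

instance : DecidableRel (heightLE (α := α)) := fun g h =>
  inferInstanceAs (Decidable (0 ≤ height (g⁻¹ * h).toWord))

lemma heightLE_mul_left (k g h : FreeGroup α) : heightLE (k * g) (k * h) ↔ heightLE g h := by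
  simp [heightLE, mul_assoc]

lemma odd_height_toWord {g : FreeGroup α} (hg : g ≠ 1) : Odd (height g.toWord) :=
  odd_height FreeGroup.isReduced_toWord (by simpa using hg)

lemma height_inv (g : FreeGroup α) : height g⁻¹.toWord = -height g.toWord := by
  rw [FreeGroup.toWord_inv, height_invRev]

instance : Std.Total (heightLE (α := α)) where
  total g h := by
    have : h⁻¹ * g = (g⁻¹ * h)⁻¹ := by group
    unfold heightLE
    rw [this, height_inv]
    omega

instance : Std.Antisymm (heightLE (α := α)) where
  antisymm g h h1 h2 := by
    have h3 : h⁻¹ * g = (g⁻¹ * h)⁻¹ := by group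
    unfold heightLE at h1 h2
    rw [h3, height_inv] at h2
    by_contra hne
    have := odd_height_toWord (g := g⁻¹ * h) (by rwa [ne_eq, inv_mul_eq_one])
    rw [show height (g⁻¹ * h).toWord = 0 by omega] at this
    simp at this

instance : IsTrans (FreeGroup α) heightLE where
  trans g h k h1 h2 := by
    rcases eq_or_ne g h with rfl | hgh
    · exact h2
    rcases eq_or_ne h k with rfl | hhk
    · exact h1
    unfold heightLE at *
    have h3 := height_mul_ge (g⁻¹ * h) (h⁻¹ * k)
    rw [show g⁻¹ * h * (h⁻¹ * k) = g⁻¹ * k by group] at h3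
    obtain ⟨a, ha⟩ := odd_height_toWord (g := g⁻¹ * h) (by rwa [ne_eq, inv_mul_eq_one])
    omega

end FreeGroupOrder

/-! ### Generic identifiers -/

section GenericIdentifiers

open Filter

variable {β : Type} [DecidableEq β]

/-- The iterated product of a nonprincipal ultrafilter on `ℕ` along a list of nodes: a property of
`ι : β → ℕ` holds generically along `s₁, …, sₘ` if for most values of `ι s₁`, for most values of
`ι s₂` (which may depend on `ι s₁`), and so on, it holds; the other values of `ι` are zero. -/
noncomputable def genericIds : List β → Ultrafilter (β → ℕ)
  | [] => pure 0
  | s :: l => (hyperfilter ℕ).bind fun i => (genericIds l).map fun ι => Function.update ι s i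

lemma eventually_genericIds_cons {s : β} {l : List β} {P : (β → ℕ) → Prop} :
    (∀ᶠ ι in genericIds (s :: l), P ι) ↔
      ∀ᶠ i in hyperfilter ℕ, ∀ᶠ ι in genericIds l, P (Function.update ι s i) :=
  Iff.rfl

/-- Nodes on which a property does not depend can be left out of the list. -/
lemma eventually_genericIds_filter {B : Finset β} {P : (β → ℕ) → Prop}
    (hP : ∀ ι ι' : β → ℕ, (∀ b ∈ B, ι b = ι' b) → P ι → P ι') (l : List β) :
    (∀ᶠ ι in genericIds l, P ι) ↔ ∀ᶠ ι in genericIds (l.filter (· ∈ B)), P ι := by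
  induction l generalizing P with
  | nil => rfl
  | cons s l ih =>
    rw [eventually_genericIds_cons]
    by_cases hs : s ∈ B
    · rw [List.filter_cons_of_pos (by simpa using hs), eventually_genericIds_cons]
      refine eventually_congr (Eventually.of_forall fun i => ?_)
      refine ih fun ι ι' h => hP _ _ fun b hb => ?_
      by_cases hbs : b = s
      · subst hbs; simp
      · simp [hbs, h b hb]
    · rw [List.filter_cons_of_neg (by simpa using hs), ← ih hP]
      have key : ∀ i ι, P (Function.update ι s i) ↔ P ι := by
        intro i ι
        have h : ∀ b ∈ B, Function.update ι s i b = ι b := by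
          rintro b hb
          rw [Function.update_of_ne]
          rintro rfl
          exact hs hb
        exact ⟨hP _ _ h, hP _ _ fun b hb => (h b hb).symm⟩
      simp only [key, eventually_const]

lemma eventually_genericIds_map (e : β ≃ β) {P : (β → ℕ) → Prop} (l : List β) :
    (∀ᶠ ι in genericIds (l.map e), P ι) ↔ ∀ᶠ ι in genericIds l, P (ι ∘ e.symm) := by
  induction l generalizing P with
  | nil => rfl
  | cons s l ih =>
    rw [List.map_cons, eventually_genericIds_cons, eventually_genericIds_cons]
    refine eventually_congr (Eventually.of_forall fun i => ?_)
    rw [ih]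
    have : ∀ ι : β → ℕ, Function.update (ι ∘ e.symm) (e s) i = Function.update ι s i ∘ e.symm := by
      intro ι
      rw [Function.update_comp_equiv]
      simp
    simp only [this]

lemma eventually_genericIds_injOn (A : Finset ℕ) (l : List β) (hl : l.Nodup) :
    ∀ᶠ ι in genericIds l, Set.InjOn ι {s | s ∈ l} ∧ ∀ s ∈ l, ι s ∉ A := by
  induction l generalizing A with
  | nil => exact Eventually.of_forall fun ι => by simp
  | cons s l ih =>
    rw [List.nodup_cons] at hl
    rw [eventually_genericIds_cons]
    have hA : ∀ᶠ i in hyperfilter ℕ, i ∉ A := compl_mem_hyperfilter_of_finite A.finite_toSet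
    filter_upwards [hA] with i hi
    filter_upwards [ih (insert i A) hl.2] with ι ⟨h1, h2⟩
    have hne : ∀ t ∈ l, t ≠ s := by rintro t ht rfl; exact hl.1 ht
    have hset : {t | t ∈ s :: l} = insert s {t | t ∈ l} := by ext; simp
    refine ⟨?_, ?_⟩
    · rw [hset, Set.injOn_insert (by simpa using hl.1)]
      refine ⟨fun x hx y hy hxy => ?_, ?_⟩
      · rw [Function.update_of_ne (hne x hx), Function.update_of_ne (hne y hy)] at hxy
        exact h1 hx hy hxy
      · rintro ⟨t, ht, h⟩
        rw [Function.update_of_ne (hne t ht), Function.update_self] at h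
        exact h2 t ht (by simp [h])
    · intro t ht
      rcases List.mem_cons.1 ht with rfl | ht
      · simpa using hi
      · rw [Function.update_of_ne (hne t ht)]
        exact fun h => h2 t ht (Finset.mem_insert_of_mem h)

/-- The value that a function with finitely many values takes almost everywhere with respect to an
ultrafilter. -/
noncomputable def ultraValue {γ C : Type} [Finite C] (U : Ultrafilter γ) (f : γ → C) : C :=
  (Ultrafilter.eventually_exists_iff (f := U) (P := fun c a => f a = c)).1
    (Eventually.of_forall fun a => ⟨f a, rfl⟩) |>.choose

lemma eventually_eq_ultraValue {γ C : Type} [Finite C] (U : Ultrafilter γ) (f : γ → C) :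
    ∀ᶠ a in U, f a = ultraValue U f :=
  ((Ultrafilter.eventually_exists_iff (f := U) (P := fun c a => f a = c)).1
    (Eventually.of_forall fun a => ⟨f a, rfl⟩)).choose_spec

end GenericIdentifiers

/-! ### Subtrees of the Cayley tree -/

section CayleyTree

variable {α : Type}

/-- The element of the free group given by a letter. -/
def ofLetter (x : α × Bool) : FreeGroup α := FreeGroup.mk [x]

lemma ofLetter_invLetter (x : α × Bool) : ofLetter (invLetter x) = (ofLetter x)⁻¹ := by
  simp [ofLetter, invLetter, FreeGroup.invRev]

@[simp] lemma mul_ofLetter_mul_invLetter (g : FreeGroup α) (x : α × Bool) :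
    g * ofLetter x * ofLetter (invLetter x) = g := by
  simp [ofLetter_invLetter]

lemma ofLetter_injective : Function.Injective (ofLetter (α := α)) := by
  classical
  intro x y h
  have := congrArg FreeGroup.toWord h
  simpa [ofLetter, FreeGroup.toWord_mk] using this

lemma ofLetter_ne_one (x : α × Bool) : ofLetter x ≠ 1 := by
  classical
  intro h
  have := congrArg FreeGroup.toWord h
  simp [ofLetter, FreeGroup.toWord_mk] at this

open Classical in
/-- The letters that lead from `g` to another element of `X`. -/
noncomputable def letters [Fintype α] (X : Set (FreeGroup α)) (g : FreeGroup α) :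
    Finset (α × Bool) :=
  {x | g * ofLetter x ∈ X}

@[simp] lemma mem_letters [Fintype α] {X : Set (FreeGroup α)} {g : FreeGroup α} {x : α × Bool} :
    x ∈ letters X g ↔ g * ofLetter x ∈ X := by
  simp [letters]

/-- The subgraph of the Cayley tree of the free group induced by a set of vertices. -/
def cayleyGraph (Y : Set (FreeGroup α)) : SimpleGraph Y where
  Adj a b := ∃ x, (b : FreeGroup α) = (a : FreeGroup α) * ofLetter x
  symm := ⟨by
    rintro a b ⟨x, hx⟩
    exact ⟨invLetter x, by simp [hx]⟩⟩
  loopless := ⟨by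
    rintro a ⟨x, hx⟩
    exact ofLetter_ne_one x (by simpa using hx.symm)⟩

/-- The neighbours of a vertex correspond to the letters that lead to them. -/
noncomputable def lettersEquiv [Fintype α] (Y : Set (FreeGroup α)) (a : Y) :
    letters Y a ≃ (cayleyGraph Y).neighborSet a :=
  Equiv.ofBijective
    (fun x => ⟨⟨a * ofLetter x.1, mem_letters.1 x.2⟩, ⟨x.1, rfl⟩⟩)
    ⟨fun x y h => by
      have h' : (a : FreeGroup α) * ofLetter x.1 = a * ofLetter y.1 :=
        congrArg (fun w => (w.1.1 : FreeGroup α)) h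
      exact Subtype.ext (ofLetter_injective (mul_left_cancel h')),
    fun w => by
      obtain ⟨⟨w, hw⟩, x, hx⟩ := w
      refine ⟨⟨x, mem_letters.2 (by simpa [← hx] using hw)⟩, ?_⟩
      apply Subtype.ext; apply Subtype.ext
      exact hx.symm⟩

lemma degree_cayleyGraph [Fintype α] (Y : Set (FreeGroup α)) (a : Y)
    [Fintype ((cayleyGraph Y).neighborSet a)] :
    (cayleyGraph Y).degree a = (letters Y a).card := by
  rw [← SimpleGraph.card_neighborSet_eq_degree, ← Fintype.card_congr (lettersEquiv Y a),
    Fintype.card_coe]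

variable [DecidableEq α]

lemma norm_ofLetter (x : α × Bool) : (ofLetter x).norm = 1 := by
  simp [ofLetter, FreeGroup.norm, FreeGroup.toWord_mk]

lemma toWord_mul_ofLetter (g : FreeGroup α) (x : α × Bool) :
    g.toWord = (g * ofLetter x).toWord ++ [invLetter x] ∨
      (g * ofLetter x).toWord = g.toWord ++ [x] := by
  by_cases h : g.toWord.getLast? = some (invLetter x)
  · left
    obtain ⟨l, hl⟩ := List.getLast?_eq_some_iff.1 h
    have hg : g = FreeGroup.mk l * ofLetter (invLetter x) := by
      rw [← FreeGroup.mk_toWord (x := g), hl, ofLetter, FreeGroup.mul_mk]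
    have hred : FreeGroup.IsReduced (l ++ [invLetter x]) := hl ▸ FreeGroup.isReduced_toWord
    have h2 : g * ofLetter x = FreeGroup.mk l := by rw [hg, ofLetter_invLetter]; group
    rw [h2, FreeGroup.toWord_mk, (isReduced_append_iff.1 hred).1.reduce_eq, hl]
  · right
    have h2 : g * ofLetter x = FreeGroup.mk (g.toWord ++ [x]) := by
      rw [← FreeGroup.mul_mk, FreeGroup.mk_toWord]; rfl
    rw [h2, FreeGroup.toWord_mk]
    apply FreeGroup.IsReduced.reduce_eq
    rw [isReduced_append_iff]
    refine ⟨FreeGroup.isReduced_toWord, by simp, fun y hy hxy => h ?_⟩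
    have hxy : x = invLetter y := by simpa using hxy
    rw [Option.mem_def.1 hy, hxy, invLetter_invLetter]

lemma norm_mul_ofLetter_ne (g : FreeGroup α) (x : α × Bool) :
    (g * ofLetter x).norm ≠ g.norm := by
  rcases toWord_mul_ofLetter g x with h | h <;>
  · have := congrArg List.length h
    simp only [List.length_append, List.length_singleton] at this
    unfold FreeGroup.norm
    omega

lemma eq_of_norm_mul_ofLetter_lt {g : FreeGroup α} {x y : α × Bool}
    (hx : (g * ofLetter x).norm < g.norm) (hy : (g * ofLetter y).norm < g.norm) : x = y := by
  have key : ∀ z, (g * ofLetter z).norm < g.norm → g.toWord.getLast? = some (invLetter z) := by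
    intro z hz
    rcases toWord_mul_ofLetter g z with h | h
    · rw [h]; simp
    · have := congrArg List.length h
      simp only [List.length_append, List.length_singleton] at this
      unfold FreeGroup.norm at hz
      omega
  have h := (key x hx).symm.trans (key y hy)
  have h' : invLetter x = invLetter y := by simpa using h
  simpa using congrArg invLetter h'

/-- A set of vertices of the Cayley tree that contains `1` and with every vertex the geodesic from
it to `1`; that is, a subtree rooted at `1`. -/
structure IsRootedSubtree (X : Set (FreeGroup α)) : Prop where
  one_mem : 1 ∈ X
  exists_parent : ∀ g ∈ X, g ≠ 1 → ∃ x, g * ofLetter x ∈ X ∧ (g * ofLetter x).norm < g.norm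

lemma IsRootedSubtree.connected {Y : Set (FreeGroup α)} (hY : IsRootedSubtree Y) :
    (cayleyGraph Y).Connected := by
  have key : ∀ n (a : Y), a.1.norm = n → (cayleyGraph Y).Reachable a ⟨1, hY.one_mem⟩ := by
    intro n
    induction n using Nat.strong_induction_on with
    | _ n ih =>
      rintro a rfl
      by_cases ha : a.1 = 1
      · rw [show a = ⟨1, hY.one_mem⟩ from Subtype.ext ha]
      · obtain ⟨x, hx, hlt⟩ := hY.exists_parent a a.2 ha
        have hadj : (cayleyGraph Y).Adj a ⟨_, hx⟩ := ⟨x, rfl⟩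
        exact hadj.reachable.trans (ih _ hlt _ rfl)
  have : Nonempty Y := ⟨⟨1, hY.one_mem⟩⟩
  exact ⟨fun a b => (key _ a rfl).trans (key _ b rfl).symm⟩

lemma IsRootedSubtree.isTree {Y : Set (FreeGroup α)} [Finite Y] (hY : IsRootedSubtree Y) :
    (cayleyGraph Y).IsTree := by
  classical
  rw [SimpleGraph.isTree_iff_connected_and_card]
  refine ⟨hY.connected, le_antisymm ?_ hY.connected.card_vert_le_card_edgeSet_add_one⟩
  choose p hp hlt using hY.exists_parent
  -- the map from a vertex to the edge towards its parent hits every edge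
  let r : Y := ⟨1, hY.one_mem⟩
  have hr : ∀ a : {a : Y // a ≠ r}, a.1.1 ≠ 1 := fun a h => a.2 (Subtype.ext h)
  let f : {a : Y // a ≠ r} → (cayleyGraph Y).edgeSet := fun a =>
    ⟨s(a.1, ⟨a.1.1 * ofLetter (p a.1.1 a.1.2 (hr a)), hp _ _ _⟩), by
      rw [SimpleGraph.mem_edgeSet]; exact ⟨_, rfl⟩⟩
  have key : ∀ a b : Y, ∀ h : (cayleyGraph Y).Adj a b, b.1.norm < a.1.norm →
      ∃ c, f c = ⟨s(a, b), h⟩ := by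
    rintro a b ⟨x, hx⟩ hab
    have ha : a ≠ r := by
      rintro rfl
      simp [r] at hab
    have ha' : a.1 ≠ 1 := fun h => ha (Subtype.ext h)
    refine ⟨⟨a, ha⟩, Subtype.ext ?_⟩
    have : x = p a.1 a.2 ha' := eq_of_norm_mul_ofLetter_lt (hx ▸ hab) (hlt _ a.2 ha')
    subst this
    have hb : b = ⟨a.1 * ofLetter (p a.1 a.2 ha'), hp _ _ _⟩ := Subtype.ext hx
    exact congrArg (fun c => s(a, c)) hb.symm
  have hsurj : Function.Surjective f := by
    rintro ⟨e, he⟩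
    induction e using Sym2.ind with
    | _ a b =>
      have hadj : (cayleyGraph Y).Adj a b := he
      have hne : b.1.norm ≠ a.1.norm := by
        obtain ⟨x, hx⟩ := hadj
        rw [hx]
        exact norm_mul_ofLetter_ne _ _
      rcases hne.lt_or_gt with h | h
      · exact key a b hadj h
      · obtain ⟨c, hc⟩ := key b a hadj.symm h
        exact ⟨c, hc.trans (Subtype.ext Sym2.eq_swap)⟩
  have h1 := Nat.card_le_card_of_surjective f hsurj
  have := Fintype.ofFinite Y
  have h2 : Nat.card {a : Y // a ≠ r} = Nat.card Y - 1 := by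
    rw [Nat.card_eq_fintype_card, Nat.card_eq_fintype_card, Fintype.card_subtype_compl]
    simp
  have h3 : 0 < Nat.card Y := Nat.card_pos_iff.2 ⟨⟨r⟩, inferInstance⟩
  omega

lemma finite_norm_le [Finite α] (N : ℕ) : {g : FreeGroup α | g.norm ≤ N}.Finite :=
  (List.finite_length_le (α × Bool) N).preimage FreeGroup.toWord_injective.injOn

/-- An infinite rooted subtree contains rooted subtrees of every large enough finite size that
agree with it on a given ball. -/
lemma IsRootedSubtree.exists_finite [Finite α] {X : Set (FreeGroup α)} (hX : IsRootedSubtree X)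
    (hinf : X.Infinite) (N : ℕ) : ∃ n₀, ∀ n, n₀ ≤ n → ∃ Y : Finset (FreeGroup α),
      IsRootedSubtree (Y : Set (FreeGroup α)) ∧ (Y : Set (FreeGroup α)) ⊆ X ∧
      (∀ g ∈ X, g.norm ≤ N → g ∈ Y) ∧ Y.card = n := by
  classical
  have hfin : (X ∩ {g | g.norm ≤ N}).Finite := (finite_norm_le N).inter_of_right X
  refine ⟨hfin.toFinset.card, fun n hn => ?_⟩
  induction n, hn using Nat.le_induction with
  | base =>
    refine ⟨hfin.toFinset, ⟨by simp [hX.one_mem], ?_⟩, by simp, by simp +contextual, rfl⟩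
    intro g hg hg1
    simp only [Set.Finite.coe_toFinset, Set.mem_inter_iff, Set.mem_ofPred_eq] at hg ⊢
    obtain ⟨x, hx, hlt⟩ := hX.exists_parent g hg.1 hg1
    exact ⟨x, ⟨hx, by omega⟩, hlt⟩
  | succ n hn ih =>
    obtain ⟨Y, hY, hYX, hN, rfl⟩ := ih
    obtain ⟨h, hh⟩ := (hinf.sdiff Y.finite_toSet).nonempty
    -- a missing element of least norm can be added, since its parent is not missing
    let p : ℕ → Prop := fun k => ∃ g ∈ X \ (Y : Set (FreeGroup α)), g.norm = k
    have hp : ∃ k, p k := ⟨_, h, hh, rfl⟩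
    obtain ⟨g, hg, hgk⟩ := Nat.find_spec hp
    refine ⟨insert g Y, ⟨by simp [hY.one_mem], ?_⟩, ?_, ?_, ?_⟩
    · intro k hk hk1
      rw [Finset.coe_insert, Set.mem_insert_iff] at hk
      rcases hk with rfl | hk
      · obtain ⟨x, hx, hlt⟩ := hX.exists_parent k hg.1 hk1
        refine ⟨x, ?_, hlt⟩
        by_contra hxY
        rw [Finset.coe_insert, Set.mem_insert_iff, not_or] at hxY
        exact Nat.find_min hp (hgk ▸ hlt) ⟨_, ⟨hx, hxY.2⟩, rfl⟩
      · obtain ⟨x, hx, hlt⟩ := hY.exists_parent k hk hk1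
        exact ⟨x, by simp only [Finset.coe_insert]; exact Set.mem_insert_of_mem _ hx, hlt⟩
    · rw [Finset.coe_insert]
      exact Set.insert_subset hg.1 hYX
    · exact fun k hk hkN => Finset.mem_insert_of_mem (hN k hk hkN)
    · exact Finset.card_insert_of_notMem (by simpa using hg.2)

end CayleyTree

/-! ### Local algorithms on subtrees of the Cayley tree -/

namespace LocalAlgorithm

variable (A : LocalAlgorithm.{u, v})

/-- The state of a node after a round, from its state before the round and the messages that it
receives. -/
def advance (deg : ℕ) (s : A.State) (r : Fin deg → A.Msg) : A.State :=
  match A.output deg s with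
  | some _ => s
  | none => A.update deg s r

lemma advance_congr {deg deg' : ℕ} (h : deg = deg') {s s' : A.State} (hs : s = s')
    {r : Fin deg → A.Msg} {r' : Fin deg' → A.Msg} (hr : ∀ i, r i = r' (Fin.cast h i)) :
    A.advance deg s r = A.advance deg' s' r' := by
  subst h hs
  congr 1
  exact funext hr

lemma send_congr {deg deg' : ℕ} (h : deg = deg') {s s' : A.State} (hs : s = s')
    {i : Fin deg} {i' : Fin deg'} (hi : (i : ℕ) = i') : A.send deg s i = A.send deg' s' i' := by
  subst h hs
  congr 1
  exact Fin.ext hi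

variable {α : Type} [Fintype α]

/-- The state of each element of `X` after `t` rounds of the algorithm on the subgraph of the Cayley
tree induced by `X`, if the algorithm believes that there are `n` nodes. The set `X` may be
infinite. The ports of a node are numbered by a fixed enumeration of the set of letters that lead
to its neighbours. -/
noncomputable def simState (X : Set (FreeGroup α)) (ι : FreeGroup α → ℕ) (n : ℕ) :
    ℕ → X → A.State
  | 0, g => A.init n (ι g) (letters X g).card
  | t + 1, g =>
    A.advance (letters X g).card (simState X ι n t g) fun i =>
      let x := (letters X g).equivFin.symm i
      A.send (letters X (g * ofLetter x.1)).card
        (simState X ι n t ⟨g * ofLetter x.1, mem_letters.1 x.2⟩)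
        ((letters X (g * ofLetter x.1)).equivFin ⟨invLetter x.1, by simp⟩)

lemma equivFin_symm_cast {γ : Type} {L L' : Finset γ} (h : L = L') (hc : L.card = L'.card)
    (i : Fin L.card) : ((L'.equivFin.symm (Fin.cast hc i)) : γ) = L.equivFin.symm i := by
  subst h
  rfl

lemma equivFin_val_congr {γ : Type} {L L' : Finset γ} (h : L = L') {x y : γ} (hxy : x = y)
    (hx : x ∈ L) (hy : y ∈ L') :
    (L.equivFin ⟨x, hx⟩ : ℕ) = L'.equivFin ⟨y, hy⟩ := by
  subst h hxy
  rfl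

variable {A}

/-- The state of a node after `t` rounds depends only on its neighbourhood of radius `t`, where the
degrees of the nodes at distance `t` count as part of it. The two nodes may lie at different places
of the Cayley tree. -/
lemma simState_congr [DecidableEq α] {X X' : Set (FreeGroup α)} {ι ι' : FreeGroup α → ℕ} (n t : ℕ)
    (p : X) (p' : X')
    (hX : ∀ h : FreeGroup α, h.norm ≤ t + 1 → (p.1 * h ∈ X ↔ p'.1 * h ∈ X'))
    (hι : ∀ h : FreeGroup α, h.norm ≤ t → p.1 * h ∈ X → ι (p.1 * h) = ι' (p'.1 * h)) :
    A.simState X ι n t p = A.simState X' ι' n t p' := by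
  induction t generalizing p p' with
  | zero =>
    have hL : letters X p = letters X' p' := by
      ext x
      simpa using hX (ofLetter x) (by simp [norm_ofLetter])
    have := hι 1 (by simp) (by simp)
    simp only [mul_one] at this
    simp only [simState, hL, this]
  | succ t ih =>
    have hL : letters X p = letters X' p' := by
      ext x
      simpa using hX (ofLetter x) (by simp [norm_ofLetter])
    have hc : (letters X p).card = (letters X' p').card := by rw [hL]
    simp only [simState]
    refine A.advance_congr hc ?_ fun i => ?_
    · exact ih p p' (fun h hh => hX h (by omega)) fun h hh => hι h (by omega)
    · have hx := equivFin_symm_cast hL hc i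
      set x := (letters X p).equivFin.symm i
      set x' := (letters X' p').equivFin.symm (Fin.cast hc i)
      have hL2 : letters X (p * ofLetter x.1) = letters X' (p' * ofLetter x'.1) := by
        ext y
        have hn := FreeGroup.norm_mul_le (ofLetter x.1) (ofLetter y)
        rw [norm_ofLetter, norm_ofLetter] at hn
        simpa [hx, mul_assoc] using hX (ofLetter x.1 * ofLetter y) (by omega)
      refine A.send_congr (by rw [hL2]) ?_ (equivFin_val_congr hL2 (by rw [hx]) _ _)
      refine ih _ _ (fun h hh => ?_) fun h hh hm => ?_
      · have hn := FreeGroup.norm_mul_le (ofLetter x.1) h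
        rw [norm_ofLetter] at hn
        change p.1 * ofLetter x.1 * h ∈ X ↔ p'.1 * ofLetter x'.1 * h ∈ X'
        rw [mul_assoc, mul_assoc, hx]
        exact hX (ofLetter x.1 * h) (by omega)
      · have hn := FreeGroup.norm_mul_le (ofLetter x.1) h
        rw [norm_ofLetter] at hn
        change p.1 * ofLetter x.1 * h ∈ X at hm
        change ι (p.1 * ofLetter x.1 * h) = ι' (p'.1 * ofLetter x'.1 * h)
        rw [mul_assoc] at hm
        rw [mul_assoc, mul_assoc, hx]
        exact hι (ofLetter x.1 * h) (by omega) hm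

/-- The port numbering of a subgraph of the Cayley tree that the simulated states refer to. -/
noncomputable def cayleyPorts (Y : Set (FreeGroup α)) [Fintype Y]
    [DecidableRel (cayleyGraph Y).Adj] : PortNumbering (cayleyGraph Y) := fun a =>
  (finCongr (degree_cayleyGraph Y a)).trans ((letters Y a).equivFin.symm.trans (lettersEquiv Y a))

lemma lettersEquiv_symm_eq (Y : Set (FreeGroup α)) (a : Y) (w : (cayleyGraph Y).neighborSet a)
    (x : letters Y a) (h : (w.1 : FreeGroup α) = (a : FreeGroup α) * ofLetter x.1) :
    (lettersEquiv Y a).symm w = x := by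
  rw [Equiv.symm_apply_eq]
  exact Subtype.ext (Subtype.ext h)

lemma cayleyPorts_symm_val (Y : Set (FreeGroup α)) [Fintype Y] [DecidableRel (cayleyGraph Y).Adj]
    (a : Y) (w : (cayleyGraph Y).neighborSet a) :
    ((cayleyPorts Y a).symm w : ℕ) = (letters Y a).equivFin ((lettersEquiv Y a).symm w) := rfl

lemma stateAt_eq_simState (Y : Set (FreeGroup α)) [Fintype Y] [DecidableRel (cayleyGraph Y).Adj]
    (ι : FreeGroup α → ℕ) (t : ℕ) (a : Y) :
    A.stateAt (cayleyGraph Y) (cayleyPorts Y) (fun b => ι b) t a =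
      A.simState Y ι (Fintype.card Y) t a := by
  induction t generalizing a with
  | zero => simp only [stateAt, simState, degree_cayleyGraph]
  | succ t ih =>
    have hc := degree_cayleyGraph Y a
    have h1 : A.stateAt (cayleyGraph Y) (cayleyPorts Y) (fun b => ι b) (t + 1) a =
        A.advance ((cayleyGraph Y).degree a)
          (A.stateAt (cayleyGraph Y) (cayleyPorts Y) (fun b => ι b) t a) fun i =>
            let w := cayleyPorts Y a i
            A.send ((cayleyGraph Y).degree w.1)
              (A.stateAt (cayleyGraph Y) (cayleyPorts Y) (fun b => ι b) t w.1)
              ((cayleyPorts Y w.1).symm ⟨a, (cayleyGraph Y).adj_symm w.2⟩) := by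
      rw [stateAt, advance]
      split <;> simp_all
    rw [h1, simState]
    refine A.advance_congr hc (ih a) fun i => ?_
    set x := (letters Y a).equivFin.symm (Fin.cast hc i) with hx
    have hw : cayleyPorts Y a i = lettersEquiv Y a x := rfl
    refine A.send_congr ?_ ?_ ?_
    · rw [degree_cayleyGraph]; rfl
    · exact ih _
    · refine (cayleyPorts_symm_val Y _ _).trans ?_
      refine congrArg (fun y => ((letters Y (a * ofLetter x.1)).equivFin y : ℕ)) ?_
      exact lettersEquiv_symm_eq Y _ _ _ (mul_ofLetter_mul_invLetter a.1 x.1).symm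

end LocalAlgorithm

/-! ### Residues of dyadic denominators -/

section DyadicResidue

/-- The rational numbers `x` for which `2 ^ (d - 1) * x` is a `2`-adic integer. -/
def DyadicIntegral (d : ℕ) (x : ℚ) : Prop := ‖((2 ^ (d - 1) * x : ℚ) : ℚ_[2])‖ ≤ 1

open Classical in
/-- The residue of `2 ^ (d - 1) * x` modulo `2 ^ d`; it is zero if `2 ^ (d - 1) * x` is not a
`2`-adic integer. -/
noncomputable def dyadicResidue (d : ℕ) (x : ℚ) : ZMod (2 ^ d) :=
  if h : DyadicIntegral d x then PadicInt.toZModPow d ⟨_, h⟩ else 0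

lemma dyadicIntegral_zero (d : ℕ) : DyadicIntegral d 0 := by
  simp [DyadicIntegral]

lemma dyadicIntegral_of_mem_RLe {d : ℕ} {x : ℚ} (hx : x ∈ RLe (d - 1)) : DyadicIntegral d x := by
  obtain ⟨i, hi, -, -, hden⟩ := hx
  unfold DyadicIntegral
  rw [evenPart, if_neg x.den_nz] at hden
  have hv : padicValNat 2 x.den = i := Nat.pow_right_injective le_rfl hden
  have hd : x = x.num / x.den := (Rat.num_div_den x).symm
  have hden0 : (x.den : ℚ) ≠ 0 := by exact_mod_cast x.den_nz
  obtain ⟨m, hm⟩ : 2 ^ i ∣ x.den := hv ▸ pow_padicValNat_dvd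
  have hm2 : ¬ 2 ∣ m := by
    rintro ⟨k, rfl⟩
    have h2 : 2 ^ (i + 1) ∣ x.den := ⟨k, by rw [hm]; ring⟩
    have := (padicValNat_dvd_iff_le x.den_nz).1 h2
    omega
  have hm0 : (m : ℚ) ≠ 0 := by
    rintro h
    have : m = 0 := by exact_mod_cast h
    exact hm2 (this ▸ dvd_zero 2)
  have hxm : 2 ^ (d - 1) * x = ((2 ^ (d - 1 - i) * x.num : ℤ) : ℚ) / (m : ℚ) := by
    rw [eq_div_iff hm0]
    have h1 : x * (2 ^ i * m) = x.num := by
      have h2 : ((x.den : ℕ) : ℚ) = 2 ^ i * m := by exact_mod_cast hm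
      rw [← h2]
      exact Rat.mul_den_eq_num x
    push_cast
    rw [← h1, show (2 : ℚ) ^ (d - 1) = 2 ^ (d - 1 - i) * 2 ^ i by rw [← pow_add]; congr 1; omega]
    ring
  rw [hxm]
  push_cast
  rw [norm_div]
  have h3 : ‖(m : ℚ_[2])‖ = 1 := by
    rw [Padic.norm_natCast_eq_one_iff]
    exact (Nat.Prime.coprime_iff_not_dvd Nat.prime_two).2 hm2
  rw [h3, div_one]
  have := Padic.norm_int_le_one (p := 2) (2 ^ (d - 1 - i) * x.num)
  push_cast at this
  exact this

lemma dyadicResidue_zero (d : ℕ) : dyadicResidue d 0 = 0 := by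
  rw [dyadicResidue, dif_pos (dyadicIntegral_zero d)]
  convert map_zero (PadicInt.toZModPow (p := 2) d)
  simp

lemma sum_dyadicResidue {γ : Type} (s : Finset γ) (d : ℕ) (f : γ → ℚ)
    (hf : ∀ i, DyadicIntegral d (f i)) (hsum : ∑ i ∈ s, f i = 1) :
    ∑ i ∈ s, dyadicResidue d (f i) = 2 ^ (d - 1) := by
  let f' : γ → ℤ_[2] := fun i => ⟨((2 ^ (d - 1) * f i : ℚ) : ℚ_[2]), hf i⟩
  have h1 : ∀ i, dyadicResidue d (f i) = PadicInt.toZModPow d (f' i) := fun i => dif_pos (hf i)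
  have h2 : ∑ i ∈ s, f' i = 2 ^ (d - 1) := by
    have h3 : ((2 ^ (d - 1) : ℤ_[2]) : ℚ_[2]) = 2 ^ (d - 1) := by
      rw [PadicInt.coe_pow]
      rfl
    apply PadicInt.ext
    rw [PadicInt.coe_sum, h3]
    change ∑ i ∈ s, ((2 ^ (d - 1) * f i : ℚ) : ℚ_[2]) = _
    rw [← Rat.cast_sum, ← Finset.mul_sum, hsum]
    push_cast
    ring
  rw [Finset.sum_congr rfl fun i _ => h1 i, ← map_sum, h2, map_pow, map_ofNat]

end DyadicResidue

/-! ### Colours of nodes -/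

namespace LocalAlgorithm

variable (A : LocalAlgorithm.{u, v}) {α : Type} [Fintype α]

/-- The value announced for the edge at the letter `x` by a node in state `s` whose edges are at the
letters in `L`; it is zero if there is no such edge or the node has not stopped. -/
noncomputable def announced (L : Finset (α × Bool)) (s : A.State) (x : α × Bool) : ℚ :=
  open Classical in
  match A.output L.card s with
  | some y => if h : x ∈ L then y (L.equivFin ⟨x, h⟩) else 0
  | none => 0

/-- What the lower bound argument records about a node: the residues of the values that it announces
for its edges, and whether these values sum to one. There are finitely many colours. -/
abbrev Colour (α : Type) (d : ℕ) : Type := (α × Bool → ZMod (2 ^ d)) × Prop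

/-- The colour of a node after `T` rounds. -/
noncomputable def colour (d T : ℕ) (X : Set (FreeGroup α)) (ι : FreeGroup α → ℕ) (n : ℕ) (p : X) :
    Colour α d :=
  (fun x => dyadicResidue d (A.announced (letters X p) (A.simState X ι n T p) x),
    ∑ x, A.announced (letters X p) (A.simState X ι n T p) x = 1)

variable {A}

lemma output_congr {deg deg' : ℕ} (h : deg = deg') {s s' : A.State} (hs : s = s')
    {f : Fin deg → ℚ} (hf : A.output deg s = some f) :
    A.output deg' s' = some fun i => f (Fin.cast h.symm i) := by
  subst h hs
  exact hf

section Congr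

variable [DecidableEq α]

lemma colour_congr {X X' : Set (FreeGroup α)} {ι ι' : FreeGroup α → ℕ} (d T n : ℕ)
    (p : X) (p' : X')
    (hX : ∀ h : FreeGroup α, h.norm ≤ T + 1 → (p.1 * h ∈ X ↔ p'.1 * h ∈ X'))
    (hι : ∀ h : FreeGroup α, h.norm ≤ T → p.1 * h ∈ X → ι (p.1 * h) = ι' (p'.1 * h)) :
    A.colour d T X ι n p = A.colour d T X' ι' n p' := by
  have hL : letters X p = letters X' p' := by
    ext x
    simpa using hX (ofLetter x) (by simp [norm_ofLetter])
  rw [colour, colour, simState_congr n T p p' hX hι, hL]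

end Congr

/-- What the announced values satisfy if the algorithm succeeds on a finite subtree. -/
lemma announced_spec {d T n : ℕ} {Y : Set (FreeGroup α)} [Fintype Y] [DecidableEq Y]
    [DecidableRel (cayleyGraph Y).Adj] {ι : FreeGroup α → ℕ} (hn : Fintype.card Y = n)
    (h : A.SolvesOn T (RLe (d - 1)) (cayleyGraph Y) (cayleyPorts Y) (fun b => ι b)) :
    let ann : Y → α × Bool → ℚ := fun a => A.announced (letters Y a) (A.simState Y ι n T a)
    (∀ a x, DyadicIntegral d (ann a x)) ∧
    (∀ a x, ∀ hx : a.1 * ofLetter x ∈ Y, ann a x = ann ⟨a.1 * ofLetter x, hx⟩ (invLetter x)) ∧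
    (∀ a x, ∀ hx : a.1 * ofLetter x ∈ Y,
      ∑ y, ann a y = 1 ∨ ∑ y, ann ⟨a.1 * ofLetter x, hx⟩ y = 1) := by
  intro ann
  obtain ⟨sol, hout, hS, hmax⟩ := h
  have hann : ∀ a x, ∀ hx : a.1 * ofLetter x ∈ Y, ann a x = sol s(a, ⟨a.1 * ofLetter x, hx⟩) := by
    intro a x hx
    have hx' : x ∈ letters Y a := mem_letters.2 hx
    have h1 := output_congr (degree_cayleyGraph Y a) (stateAt_eq_simState Y ι T a) (hout a)
    rw [hn] at h1
    simp only [ann, announced, h1, dif_pos hx']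
    congr 1
    have h2 : (cayleyPorts Y a (Fin.cast (degree_cayleyGraph Y a).symm
        ((letters Y a).equivFin ⟨x, hx'⟩))) = lettersEquiv Y a ⟨x, hx'⟩ := by
      simp only [cayleyPorts, Equiv.trans_apply, finCongr_apply, Fin.cast_cast, Fin.cast_eq_self,
        Equiv.symm_apply_apply]
    rw [h2]
    rfl
  have hann0 : ∀ a x, a.1 * ofLetter x ∉ Y → ann a x = 0 := by
    intro a x hx
    have hx' : x ∉ letters Y a := fun h => hx (mem_letters.1 h)
    simp only [ann, announced, dif_neg hx']
    split <;> rfl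
  have hadj : ∀ a x, ∀ hx : a.1 * ofLetter x ∈ Y, (cayleyGraph Y).Adj a ⟨a.1 * ofLetter x, hx⟩ :=
    fun a x hx => ⟨x, rfl⟩
  have hsum : ∀ a, ∑ x, ann a x = nodeSum (cayleyGraph Y) sol a := by
    intro a
    rw [nodeSum, ← Finset.sum_subset (Finset.subset_univ (letters Y a)) fun x _ hx =>
      hann0 a x fun h => hx (mem_letters.2 h)]
    refine Finset.sum_bij (fun x hx => s(a, ⟨a.1 * ofLetter x, mem_letters.1 hx⟩)) ?_ ?_ ?_ ?_
    · intro x hx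
      rw [SimpleGraph.mem_incidenceFinset]
      exact ⟨hadj _ _ _, Sym2.mem_mk_left _ _⟩
    · intro x hx y hy hxy
      rw [Sym2.congr_right] at hxy
      exact ofLetter_injective (mul_left_cancel (congrArg Subtype.val hxy))
    · intro e he
      rw [SimpleGraph.mem_incidenceFinset] at he
      obtain ⟨he, hae⟩ := he
      obtain ⟨b, rfl⟩ := Sym2.mem_iff_exists.1 hae
      obtain ⟨x, hx⟩ : (cayleyGraph Y).Adj a b := he
      refine ⟨x, mem_letters.2 (hx ▸ b.2), ?_⟩
      rw [Sym2.congr_right]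
      exact Subtype.ext hx.symm
    · intro x hx
      exact hann a x (mem_letters.1 hx)
  refine ⟨fun a x => ?_, fun a x hx => ?_, fun a x hx => ?_⟩
  · by_cases hx : a.1 * ofLetter x ∈ Y
    · rw [hann a x hx]
      exact dyadicIntegral_of_mem_RLe (hS _ (hadj a x hx))
    · rw [hann0 a x hx]
      exact dyadicIntegral_zero d
  · rw [hann a x hx, hann _ (invLetter x) (by simp), Sym2.eq_swap]
    congr 2
    exact Subtype.ext (mul_ofLetter_mul_invLetter a.1 x).symm
  · rw [hsum, hsum]
    exact hmax.saturated _ _ (hadj a x hx)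

end LocalAlgorithm

/-! ### Generic colours -/

section Ball

variable {α : Type} [LinearOrder α] [Fintype α]

/-- The ball around the root of the Cayley tree. -/
noncomputable def ball (α : Type) [LinearOrder α] [Fintype α] (N : ℕ) : Finset (FreeGroup α) :=
  (finite_norm_le N).toFinset

@[simp] lemma mem_ball {N : ℕ} {g : FreeGroup α} : g ∈ ball α N ↔ g.norm ≤ N := by
  simp [ball]

end Ball

/-- The set `X` as seen from its element `p`: the translate of `X` that moves `p` to the root. -/
def seenFrom {α : Type} (X : Set (FreeGroup α)) (p : FreeGroup α) : Set (FreeGroup α) :=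
  (p * ·) ⁻¹' X

namespace LocalAlgorithm

open Filter

variable (A : LocalAlgorithm.{u, v}) {α : Type} [LinearOrder α] [Fintype α]

/-- The colour of the root of `X` for generic identifiers, ordered like the nodes, and a generic
number of nodes that is large compared with the identifiers. -/
noncomputable def genericColour (d T : ℕ) (X : Set (FreeGroup α)) (hX : 1 ∈ X) : Colour α d :=
  have : Finite (Colour α d) := by
    have : NeZero (2 ^ d) := ⟨by positivity⟩
    infer_instance
  ultraValue (genericIds ((ball α T).sort heightLE)) fun ι =>
    ultraValue (hyperfilter ℕ) fun n => A.colour d T X ι n ⟨1, hX⟩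

variable {A}

lemma genericColour_congr (d T : ℕ) {X X' : Set (FreeGroup α)} (hX : 1 ∈ X) (hX' : 1 ∈ X')
    (h : ∀ g : FreeGroup α, g.norm ≤ T + 1 → (g ∈ X ↔ g ∈ X')) :
    A.genericColour d T X hX = A.genericColour d T X' hX' := by
  have : ∀ ι n, A.colour d T X ι n ⟨1, hX⟩ = A.colour d T X' ι n ⟨1, hX'⟩ := fun ι n =>
    colour_congr d T n _ _ (by simpa using h) fun _ _ _ => rfl
  simp only [genericColour, this]

/-- For generic identifiers on a finite set that contains the neighbourhood of a node, the node has
the generic colour of its surroundings: the order of the nodes is left-invariant, so the order of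
the identifiers near the node is the same as near the root of the translated tree. -/
lemma eventually_colour_eq (d T : ℕ) {X : Set (FreeGroup α)} {p : FreeGroup α} (hp : p ∈ X)
    (S : Finset (FreeGroup α)) (hS : ∀ h : FreeGroup α, h.norm ≤ T → p * h ∈ S)
    (h1 : 1 ∈ seenFrom X p) :
    ∀ᶠ ι in genericIds (S.sort heightLE), ∀ᶠ n in hyperfilter ℕ,
      A.colour d T X ι n ⟨p, hp⟩ = A.genericColour d T (seenFrom X p) h1 := by
  have hfin : Finite (Colour α d) := by
    have : NeZero (2 ^ d) := ⟨by positivity⟩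
    infer_instance
  set c := A.genericColour d T (seenFrom X p) h1 with hc
  let e : FreeGroup α ≃ FreeGroup α := Equiv.mulLeft p
  let B : Finset (FreeGroup α) := (ball α T).map e.toEmbedding
  have hB : ∀ h : FreeGroup α, h.norm ≤ T → p * h ∈ B := fun h hh =>
    Finset.mem_map.2 ⟨h, mem_ball.2 hh, rfl⟩
  have hBS : B ⊆ S := by
    intro g hg
    obtain ⟨h, hh, rfl⟩ := Finset.mem_map.1 hg
    exact hS h (mem_ball.1 hh)
  have hbase : ∀ᶠ ι in genericIds ((ball α T).sort heightLE), ∀ᶠ n in hyperfilter ℕ,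
      A.colour d T (seenFrom X p) ι n ⟨1, h1⟩ = c := by
    filter_upwards [eventually_eq_ultraValue (genericIds ((ball α T).sort heightLE)) fun ι =>
      ultraValue (hyperfilter ℕ) fun n => A.colour d T (seenFrom X p) ι n ⟨1, h1⟩] with ι hι
    filter_upwards [eventually_eq_ultraValue (hyperfilter ℕ) fun n =>
      A.colour d T (seenFrom X p) ι n ⟨1, h1⟩] with n hn
    rw [hn, hι]
    rfl
  have hshift : ∀ ι n, A.colour d T (seenFrom X p) (ι ∘ e) n ⟨1, h1⟩ =
      A.colour d T X ι n ⟨p, hp⟩ := fun ι n =>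
    colour_congr d T n _ _ (fun h _ => by simp [seenFrom]) fun h _ _ => by simp [e]
  have hmap : ((ball α T).sort heightLE).map e = B.sort heightLE :=
    Finset.map_sort e.toEmbedding (ball α T) heightLE heightLE fun a _ b _ =>
      (heightLE_mul_left p a b).symm
  have hfilter : (S.sort heightLE).filter (· ∈ B) = B.sort heightLE := by
    apply List.Perm.eq_of_pairwise' (r := heightLE)
    · exact (Finset.pairwise_sort S heightLE).filter _
    · exact Finset.pairwise_sort B heightLE
    · rw [List.perm_ext_iff_of_nodup ((Finset.sort_nodup S heightLE).filter _)
        (Finset.sort_nodup B heightLE)]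
      intro g
      simpa using fun hg => hBS hg
  rw [eventually_genericIds_filter (B := B), hfilter, ← hmap, eventually_genericIds_map]
  · simp only [← hshift]
    simpa [Function.comp_assoc] using hbase
  · intro ι ι' h hev
    have : ∀ n, A.colour d T X ι n ⟨p, hp⟩ = A.colour d T X ι' n ⟨p, hp⟩ := fun n =>
      colour_congr d T n _ _ (fun _ _ => Iff.rfl) fun g hg _ => h _ (hB g hg)
    simpa only [this] using hev

/-- The generic colours of two adjacent nodes of an infinite subtree satisfy the constraints of a
maximal fractional matching. -/
lemma genericColour_spec {d T c : ℕ} (hc : 1 ≤ c)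
    (hA : A.SolvesOnTrees T c (2 * Fintype.card α) (RLe (d - 1)))
    {X : Set (FreeGroup α)} (hX : IsRootedSubtree X) (hinf : X.Infinite) {x : α × Bool}
    (hx : ofLetter x ∈ X) (h1 : 1 ∈ seenFrom X (ofLetter x)) :
    (A.genericColour d T X hX.one_mem).1 x =
      (A.genericColour d T (seenFrom X (ofLetter x)) h1).1 (invLetter x) ∧
    ((A.genericColour d T X hX.one_mem).2 →
      ∑ y, (A.genericColour d T X hX.one_mem).1 y = 2 ^ (d - 1)) ∧
    ((A.genericColour d T X hX.one_mem).2 ∨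
      (A.genericColour d T (seenFrom X (ofLetter x)) h1).2) := by
  classical
  obtain ⟨n₀, hn₀⟩ := hX.exists_finite hinf (T + 2)
  let S := ball α (T + 2)
  have h1' : 1 ∈ seenFrom X 1 := by simpa [seenFrom] using hX.one_mem
  have hroot : A.genericColour d T (seenFrom X 1) h1' = A.genericColour d T X hX.one_mem :=
    genericColour_congr d T _ _ (by simp [seenFrom])
  have hS1 : ∀ h : FreeGroup α, h.norm ≤ T → 1 * h ∈ S := fun h hh => by
    rw [one_mul]; exact mem_ball.2 (by omega)
  have hnx : ∀ h : FreeGroup α, (ofLetter x * h).norm ≤ h.norm + 1 := fun h => by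
    have := FreeGroup.norm_mul_le (ofLetter x) h
    rw [norm_ofLetter] at this
    omega
  have hSx : ∀ h : FreeGroup α, h.norm ≤ T → ofLetter x * h ∈ S := fun h hh =>
    mem_ball.2 ((hnx h).trans (by omega))
  obtain ⟨ι, ⟨hinj, hpos⟩, hι1, hιx⟩ :=
    ((eventually_genericIds_injOn {0} (S.sort heightLE) (Finset.sort_nodup S _)).and
      ((eventually_colour_eq (A := A) d T hX.one_mem S hS1 h1').and
        (eventually_colour_eq (A := A) d T hx S hSx h1))).exists
  have hlarge : ∀ᶠ n in hyperfilter ℕ, max n₀ (S.sup ι) ≤ n :=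
    Nat.hyperfilter_le_atTop (eventually_ge_atTop _)
  obtain ⟨n, hn, hn1, hnX⟩ := (hlarge.and (hι1.and hιx)).exists
  obtain ⟨Y, hY, hYX, hball, hcard⟩ := hn₀ n ((le_max_left _ _).trans hn)
  have hcardY : Fintype.card (Y : Set (FreeGroup α)) = n := by simp [hcard]
  -- extend the generic identifiers to all nodes of the finite tree
  obtain ⟨g, hg⟩ := Finset.exists_equiv_extend_of_card_eq (α := (Y : Set (FreeGroup α)))
    (t := Finset.Icc 1 n) (by simp [hcard]) (s := {a | a.1 ∈ S}) (f := fun a => ι a.1)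
    (by
      intro i hi
      obtain ⟨a, ha, rfl⟩ := Finset.mem_image.1 hi
      have ha : a.1 ∈ S := by simpa using ha
      rw [Finset.mem_Icc]
      refine ⟨Nat.one_le_iff_ne_zero.2 ?_,
        (Finset.le_sup (f := ι) ha).trans ((le_max_right _ _).trans hn)⟩
      simpa using hpos a.1 (by simpa using ha))
    (by
      intro a ha b hb hab
      exact Subtype.ext (hinj (by simpa using ha) (by simpa using hb) hab))
  let ι' : FreeGroup α → ℕ := fun a => if h : a ∈ (Y : Set (FreeGroup α)) then g ⟨a, h⟩ else 0
  have hι'Y : ∀ a : (Y : Set (FreeGroup α)), ι' a = g a := fun a => dif_pos a.2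
  have hι' : ∀ a ∈ Y, a.norm ≤ T + 2 → ι a = ι' a := by
    intro a ha han
    have := hg ⟨a, ha⟩ (by simpa [S] using han)
    rw [← this]
    exact (hι'Y ⟨a, ha⟩).symm
  have hdeg : (cayleyGraph (Y : Set (FreeGroup α))).maxDegree ≤ 2 * Fintype.card α := by
    apply SimpleGraph.maxDegree_le_of_forall_degree_le
    intro a
    rw [degree_cayleyGraph]
    refine (Finset.card_le_univ _).trans ?_
    simp [mul_comm]
  have hsolve := hA (Y : Set (FreeGroup α)) (cayleyGraph (Y : Set (FreeGroup α))) hY.isTree hdeg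
    (cayleyPorts _) (fun a => ι' a)
    (fun a b hab => by
      simp only [hι'Y] at hab
      exact g.injective (Subtype.ext hab))
    (fun a => by
      have := Finset.mem_Icc.1 (g a).2
      rw [hι'Y, hcardY]
      exact ⟨this.1, this.2.trans (Nat.le_self_pow (by omega) n)⟩)
  obtain ⟨hint, hedge, hsat⟩ := announced_spec hcardY hsolve
  have hxY : ofLetter x ∈ (Y : Set (FreeGroup α)) := hball _ hx (by rw [norm_ofLetter]; omega)
  have hmem : ∀ h : FreeGroup α, h.norm ≤ T + 2 → (h ∈ X ↔ h ∈ (Y : Set (FreeGroup α))) :=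
    fun h hh => ⟨fun hhX => hball h hhX hh, fun hhY => hYX hhY⟩
  have hcol1 : A.colour d T (Y : Set (FreeGroup α)) ι' n ⟨1, hY.one_mem⟩ =
      A.genericColour d T X hX.one_mem := by
    rw [← hroot, ← hn1]
    refine (colour_congr d T n _ _ (fun h hh => ?_) fun h hh hm => ?_).symm
    · simpa using hmem h (by omega)
    · simp only [one_mul] at hm ⊢
      exact hι' h ((hmem h (by omega)).1 hm) (by omega)
  have hcolx : A.colour d T (Y : Set (FreeGroup α)) ι' n ⟨ofLetter x, hxY⟩ =
      A.genericColour d T (seenFrom X (ofLetter x)) h1 := by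
    rw [← hnX]
    refine (colour_congr d T n _ _ (fun h hh => ?_) fun h hh hm => ?_).symm
    · exact hmem _ ((hnx h).trans (by omega))
    · have hle : (ofLetter x * h).norm ≤ T + 2 := (hnx h).trans (by omega)
      exact hι' _ ((hmem _ hle).1 hm) hle
  have hxY' : (1 : FreeGroup α) * ofLetter x ∈ (Y : Set (FreeGroup α)) := by simpa using hxY
  have hsub : (⟨1 * ofLetter x, hxY'⟩ : (Y : Set (FreeGroup α))) = ⟨ofLetter x, hxY⟩ :=
    Subtype.ext (one_mul _)
  have hedge := hedge ⟨1, hY.one_mem⟩ x hxY'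
  have hsat := hsat ⟨1, hY.one_mem⟩ x hxY'
  rw [hsub] at hedge hsat
  rw [← hcol1, ← hcolx]
  exact ⟨congrArg (dyadicResidue d) hedge, fun hs => sum_dyadicResidue _ d _ (hint _) hs, hsat⟩

end LocalAlgorithm

/-! ### Labelled graphs and their universal covers -/

/-- A graph whose edges are directed and labelled by elements of `α`, such that every node has at
most one outgoing and at most one incoming edge of each label: `step (i, true)` follows the outgoing
edge of label `i`, and `step (i, false)` goes back along the incoming one. Loops are allowed. -/
structure LabelledGraph (α V : Type) where
  step : α × Bool → V → Option V
  step_symm : ∀ {x u w}, step x u = some w → step (invLetter x) w = some u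

namespace LabelledGraph

variable {α V : Type} (G : LabelledGraph α V)

/-- The end of the walk from a node along a word, if all its steps exist. -/
def walk : List (α × Bool) → V → Option V
  | [], u => some u
  | x :: l, u => (G.step x u).bind (walk l)

lemma walk_append (l m : List (α × Bool)) (u : V) :
    G.walk (l ++ m) u = (G.walk l u).bind (G.walk m) := by
  induction l generalizing u with
  | nil => rfl
  | cons x l ih =>
    simp only [List.cons_append, walk, Option.bind_assoc]
    congr 1
    exact funext ih

/-- A walk along a word can be shortened to a walk along the reduced word. The converse fails, since
the steps of a detour may not exist. -/
lemma walk_of_red {l m : List (α × Bool)} (h : FreeGroup.Red l m) {u w : V}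
    (hl : G.walk l u = some w) : G.walk m u = some w := by
  induction h with
  | refl => exact hl
  | tail _ hs ih =>
    cases hs with
    | @not L₁ L₂ a b =>
      rw [walk_append, Option.bind_eq_some_iff] at ih
      obtain ⟨p, hp, hw⟩ := ih
      rw [walk, Option.bind_eq_some_iff] at hw
      obtain ⟨q, hq, hw⟩ := hw
      have hq' : G.step (a, !b) q = some p := G.step_symm hq
      rw [walk, hq', Option.bind_some] at hw
      rw [walk_append, hp, Option.bind_some, hw]

variable {G}

/-- The labels of the loops at a node. -/
def loops [Fintype α] [DecidableEq V] (G : LabelledGraph α V) (u : V) : Finset α :=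
  {i | G.step (i, true) u = some u}

@[simp] lemma mem_loops [Fintype α] [DecidableEq V] {u : V} {i : α} :
    i ∈ G.loops u ↔ G.step (i, true) u = some u := by
  simp [loops]

/-- `K` separates the two ends of the edge of label `i` that starts in `u`, and no other edge leads
from `K` to its complement. -/
structure IsCut (G : LabelledGraph α V) (K : Finset V) (u : V) (i : α) : Prop where
  separates : ∀ w, G.step (i, true) u = some w → (u ∈ K ↔ w ∉ K)
  closed : ∀ p j q, G.step (j, true) p = some q → (p, j) ≠ (u, i) → (p ∈ K ↔ q ∈ K)

/-- All edges that are not loops are bridges. -/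
def IsTreeLike (G : LabelledGraph α V) : Prop :=
  ∀ u i w, G.step (i, true) u = some w → w ≠ u → ∃ K, G.IsCut K u i

lemma IsCut.compl [Fintype V] [DecidableEq V] {K : Finset V} {u : V} {i : α} (h : G.IsCut K u i) :
    G.IsCut Kᶜ u i where
  separates w hw := by
    have := h.separates w hw
    simp only [Finset.mem_compl]
    tauto
  closed p j q hpq hne := by
    have := h.closed p j q hpq hne
    simp only [Finset.mem_compl]
    tauto

lemma step_false_of_loop {v₀ : V} {i₀ : α} (h : G.step (i₀, true) v₀ = some v₀) (b : Bool) :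
    G.step (i₀, b) v₀ = some v₀ := by
  cases b
  · exact G.step_symm h
  · exact h

variable [DecidableEq α]

/-- The universal cover of a labelled graph at a node `u`, as a subtree of the Cayley tree: the
reduced words along which one can walk from `u`. -/
def cover (G : LabelledGraph α V) (u : V) : Set (FreeGroup α) := {g | (G.walk g.toWord u).isSome}

lemma mem_cover {u : V} {g : FreeGroup α} : g ∈ G.cover u ↔ (G.walk g.toWord u).isSome := Iff.rfl

lemma one_mem_cover (u : V) : 1 ∈ G.cover u := by
  simp [mem_cover, walk]

lemma ofLetter_mem_cover {u w : V} {x : α × Bool} (h : G.step x u = some w) :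
    ofLetter x ∈ G.cover u := by
  simp [mem_cover, ofLetter, FreeGroup.toWord_mk, walk, h]

lemma ofLetter_notMem_cover {u : V} {x : α × Bool} (h : G.step x u = none) :
    ofLetter x ∉ G.cover u := by
  simp [mem_cover, ofLetter, FreeGroup.toWord_mk, walk, h]

lemma isRootedSubtree_cover (u : V) : IsRootedSubtree (G.cover u) where
  one_mem := one_mem_cover u
  exists_parent g hg hg1 := by
    have hne : g.toWord ≠ [] := by simpa using hg1
    set y := g.toWord.getLast hne with hy
    have hl : g.toWord = g.toWord.dropLast ++ [y] := (List.dropLast_append_getLast hne).symm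
    rcases toWord_mul_ofLetter g (invLetter y) with h | h
    · refine ⟨invLetter y, ?_, ?_⟩
      · rw [mem_cover, h, walk_append] at hg
        rw [mem_cover]
        by_contra hn
        simp [Option.not_isSome_iff_eq_none.1 hn] at hg
      · have := congrArg List.length h
        simp only [List.length_append, List.length_singleton] at this
        unfold FreeGroup.norm
        omega
    · have hred : FreeGroup.IsReduced (g.toWord ++ [invLetter y]) :=
        h ▸ FreeGroup.isReduced_toWord
      exact absurd rfl ((isReduced_append_iff.1 hred).2.2 y (by rw [hl]; simp))

lemma mul_mem_cover {u w : V} {x : α × Bool} (h : G.step x u = some w) {g : FreeGroup α}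
    (hg : g ∈ G.cover w) : ofLetter x * g ∈ G.cover u := by
  obtain ⟨z, hz⟩ := Option.isSome_iff_exists.1 hg
  have h1 : G.walk (x :: g.toWord) u = some z := by rw [walk, h, Option.bind_some, hz]
  have h2 : (ofLetter x * g).toWord = FreeGroup.reduce (x :: g.toWord) := by
    rw [← FreeGroup.toWord_mk]
    congr 1
    conv_lhs => rw [← FreeGroup.mk_toWord (x := g)]
    rfl
  rw [mem_cover, h2, G.walk_of_red FreeGroup.reduce.red h1]
  rfl

/-- Moving along an edge of a labelled graph translates the universal cover. -/
lemma seenFrom_cover {u w : V} {x : α × Bool} (h : G.step x u = some w) :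
    seenFrom (G.cover u) (ofLetter x) = G.cover w := by
  ext g
  refine ⟨fun hg => ?_, mul_mem_cover h⟩
  have := mul_mem_cover (G.step_symm h) hg
  simpa [ofLetter_invLetter] using this

/-- One can walk around a loop arbitrarily often. -/
lemma infinite_cover {u : V} {i : α} (h : G.step (i, true) u = some u) :
    (G.cover u).Infinite := by
  refine Set.infinite_of_injective_forall_mem (f := fun n : ℕ => FreeGroup.of i ^ n) ?_ ?_
  · intro m n hmn
    simpa using congrArg FreeGroup.norm hmn
  · intro n
    rw [mem_cover, FreeGroup.toWord_of_pow]
    have : ∀ n, G.walk (List.replicate n (i, true)) u = some u := by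
      intro n
      induction n with
      | zero => rfl
      | succ n ih => rw [List.replicate_succ, walk, h, Option.bind_some, ih]
    rw [this]
    rfl

/-! ### Unfolding a loop -/

/-- One step forwards or backwards on a path with `N` nodes. -/
def pathStep (N : ℕ) (b : Bool) (a : Fin N) : Option (Fin N) :=
  if b then if h : a.1 + 1 < N then some ⟨a.1 + 1, h⟩ else none
  else if a.1 = 0 then none else some ⟨a.1 - 1, by omega⟩

lemma pathStep_symm {N : ℕ} {b : Bool} {a a' : Fin N} (h : pathStep N b a = some a') :
    pathStep N (!b) a' = some a := by
  cases b
  · simp only [pathStep, Bool.false_eq_true, if_false] at h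
    split_ifs at h with h0
    obtain rfl := Option.some_injective _ h
    simp only [pathStep, Bool.not_false, if_true]
    rw [dif_pos (by omega)]
    congr 1
    ext
    simp only
    omega
  · simp only [pathStep, if_true] at h
    split_ifs at h with h0
    obtain rfl := Option.some_injective _ h
    simp [pathStep]

variable [DecidableEq V]

/-- The lift of a labelled graph to `N` copies in which the loop of label `i₀` at `v₀` is replaced by
edges that join the copies of `v₀` to a path. -/
def unfold (G : LabelledGraph α V) (v₀ : V) (i₀ : α) (h₀ : G.step (i₀, true) v₀ = some v₀) (N : ℕ) :
    LabelledGraph α (V × Fin N) where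
  step x p := if p.1 = v₀ ∧ x.1 = i₀ then (pathStep N x.2 p.2).map (Prod.mk v₀)
    else (G.step x p.1).map fun w => (w, p.2)
  step_symm := by
    rintro ⟨i, b⟩ ⟨u, a⟩ ⟨w, a'⟩ h
    simp only [invLetter] at h ⊢
    split_ifs at h with h1
    · obtain ⟨rfl, rfl⟩ := h1
      rw [Option.map_eq_some_iff] at h
      obtain ⟨a'', h2, h3⟩ := h
      obtain ⟨rfl, rfl⟩ := Prod.mk.inj h3
      refine (if_pos ⟨rfl, rfl⟩).trans ?_
      rw [pathStep_symm h2]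
      rfl
    · rw [Option.map_eq_some_iff] at h
      obtain ⟨w', h2, h3⟩ := h
      obtain ⟨rfl, rfl⟩ := Prod.mk.inj h3
      have h4 := G.step_symm h2
      simp only [invLetter] at h4
      refine (if_neg ?_).trans ?_
      · rintro ⟨rfl, rfl⟩
        rw [step_false_of_loop h₀] at h4
        exact h1 ⟨(Option.some_injective _ h4).symm, rfl⟩
      · rw [h4]
        rfl

variable {v₀ : V} {i₀ : α} {h₀ : G.step (i₀, true) v₀ = some v₀} {N : ℕ}

lemma unfold_step_loop (b : Bool) (a : Fin N) :
    (G.unfold v₀ i₀ h₀ N).step (i₀, b) (v₀, a) = (pathStep N b a).map (Prod.mk v₀) := by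
  simp [unfold]

lemma unfold_step_of_ne {x : α × Bool} {u : V} (h : ¬ (u = v₀ ∧ x.1 = i₀)) (a : Fin N) :
    (G.unfold v₀ i₀ h₀ N).step x (u, a) = (G.step x u).map fun w => (w, a) := by
  simp only [unfold]
  rw [if_neg h]

/-- Far from the ends of the path, the unfolded graph looks like the original one. -/
lemma isSome_walk_unfold (l : List (α × Bool)) (u : V) (a : Fin N) (h1 : l.length ≤ a)
    (h2 : a + l.length < N) :
    ((G.unfold v₀ i₀ h₀ N).walk l (u, a)).isSome ↔ (G.walk l u).isSome := by
  induction l generalizing u a with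
  | nil => simp [walk]
  | cons x l ih =>
    rw [List.length_cons] at h1 h2
    obtain ⟨i, b⟩ := x
    by_cases hu : u = v₀ ∧ i = i₀
    · obtain ⟨rfl, rfl⟩ := hu
      rw [walk, walk, unfold_step_loop, step_false_of_loop h₀]
      cases b
      · rw [pathStep, if_neg (by simp), if_neg (by omega)]
        exact ih _ _ (by simp only; omega) (by simp only; omega)
      · rw [pathStep, if_pos rfl, dif_pos (by omega)]
        exact ih _ _ (by simp only; omega) (by simp only; omega)
    · rw [walk, walk, unfold_step_of_ne hu]
      rcases G.step (i, b) u with _ | w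
      · simp
      · exact ih _ _ (by omega) (by omega)

lemma card_loops_le_unfold [Fintype α] (u : V) (a : Fin N) :
    (G.loops u).card ≤ ((G.unfold v₀ i₀ h₀ N).loops (u, a)).card + 1 := by
  have h : (G.loops u).erase i₀ ⊆ (G.unfold v₀ i₀ h₀ N).loops (u, a) := by
    intro i hi
    rw [Finset.mem_erase, mem_loops] at hi
    rw [mem_loops, unfold_step_of_ne (fun h => hi.1 h.2), hi.2]
    rfl
  have h2 := Finset.card_le_card h
  have h3 := Finset.pred_card_le_card_erase (s := G.loops u) (a := i₀)
  omega

lemma isCut_unfold_path [Fintype V] (a : Fin N) :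
    (G.unfold v₀ i₀ h₀ N).IsCut {p | p.2 ≤ a} (v₀, a) i₀ where
  separates w hw := by
    rw [unfold_step_loop, pathStep, if_pos rfl] at hw
    split_ifs at hw with h1
    · simp only [Option.map_some, Option.some.injEq] at hw
      subst hw
      simp [Fin.lt_def]
    · simp at hw
  closed := by
    rintro ⟨p, b⟩ j ⟨q, b'⟩ hpq hne
    by_cases hp : p = v₀ ∧ j = i₀
    · obtain ⟨rfl, rfl⟩ := hp
      rw [unfold_step_loop, pathStep, if_pos rfl] at hpq
      split_ifs at hpq with h1
      · simp only [Option.map_some, Option.some.injEq, Prod.mk.injEq] at hpq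
        obtain ⟨-, rfl⟩ := hpq
        have hba : b.1 ≠ a.1 := fun h => hne (by rw [Fin.ext h])
        simp only [Finset.mem_filter, Finset.mem_univ, true_and, Fin.le_def]
        omega
      · simp at hpq
    · rw [unfold_step_of_ne hp, Option.map_eq_some_iff] at hpq
      obtain ⟨w, -, h⟩ := hpq
      obtain ⟨rfl, rfl⟩ := Prod.mk.inj h
      simp

lemma isTreeLike_unfold [Fintype V] (hG : G.IsTreeLike) :
    (G.unfold v₀ i₀ h₀ N).IsTreeLike := by
  rintro ⟨u, a⟩ i ⟨w, a'⟩ h hne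
  by_cases hu : u = v₀ ∧ i = i₀
  · obtain ⟨rfl, rfl⟩ := hu
    exact ⟨_, isCut_unfold_path a⟩
  · rw [unfold_step_of_ne hu, Option.map_eq_some_iff] at h
    obtain ⟨w', hw, h'⟩ := h
    obtain ⟨rfl, rfl⟩ := Prod.mk.inj h'
    -- the side of the bridge without `v₀` is not connected to other copies
    obtain ⟨K, hK, hv⟩ : ∃ K, G.IsCut K u i ∧ v₀ ∉ K := by
      obtain ⟨K, hK⟩ := hG u i w' hw fun h => hne (by rw [h])
      by_cases hv : v₀ ∈ K
      · exact ⟨Kᶜ, hK.compl, by simpa using hv⟩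
      · exact ⟨K, hK, hv⟩
    refine ⟨K ×ˢ {a}, ⟨fun q hq => ?_, ?_⟩⟩
    · rw [unfold_step_of_ne hu, hw] at hq
      obtain rfl : (w', a) = q := by simpa using hq
      simpa using hK.separates w' hw
    · rintro ⟨p, b⟩ j ⟨q, b'⟩ hpq hne'
      by_cases hp : p = v₀ ∧ j = i₀
      · obtain ⟨rfl, rfl⟩ := hp
        rw [unfold_step_loop, Option.map_eq_some_iff] at hpq
        obtain ⟨_, -, h⟩ := hpq
        obtain ⟨rfl, rfl⟩ := Prod.mk.inj h
        simp [hv]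
      · rw [unfold_step_of_ne hp, Option.map_eq_some_iff] at hpq
        obtain ⟨w, hw, h⟩ := hpq
        obtain ⟨rfl, rfl⟩ := Prod.mk.inj h
        by_cases hb : b = a
        · subst hb
          have := hK.closed p j w hw fun h => hne' (by
            obtain ⟨rfl, rfl⟩ := Prod.mk.inj h
            rfl)
          simpa using this
        · simp [Ne.symm hb]

end LabelledGraph

/-! ### Divisibility of the values -/

namespace LocalAlgorithm

variable {A : LocalAlgorithm.{u, v}} {α : Type} [LinearOrder α] [Fintype α]

lemma genericColour_eq_zero (d T : ℕ) {X : Set (FreeGroup α)} (hX : 1 ∈ X) {x : α × Bool}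
    (hx : ofLetter x ∉ X) : (A.genericColour d T X hX).1 x = 0 := by
  have h1 : 1 ∈ seenFrom X 1 := by simpa [seenFrom] using hX
  obtain ⟨ι, hι⟩ := (eventually_colour_eq (A := A) d T hX (ball α T)
    (fun h hh => by simpa using hh) h1).exists
  obtain ⟨n, hn⟩ := hι.exists
  have hroot : A.genericColour d T (seenFrom X 1) h1 = A.genericColour d T X hX :=
    genericColour_congr d T _ _ (by simp [seenFrom])
  rw [← hroot, ← hn]
  have hx' : x ∉ letters X (1 : FreeGroup α) := by simpa using hx
  have : A.announced (letters X (1 : FreeGroup α)) (A.simState X ι n T ⟨1, hX⟩) x = 0 := by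
    simp only [announced, dif_neg hx']
    split <;> rfl
  simp only [colour, this, dyadicResidue_zero]

variable (A)

/-- The generic colour of the node above `u` in the universal cover of a labelled graph. -/
noncomputable def nodeColour (d T : ℕ) {V : Type} (G : LabelledGraph α V) (u : V) : Colour α d :=
  A.genericColour d T (G.cover u) (LabelledGraph.one_mem_cover u)

variable {A} {d T c : ℕ} {V : Type} {G : LabelledGraph α V}

lemma nodeColour_eq_zero {u : V} {x : α × Bool} (h : G.step x u = none) :
    (A.nodeColour d T G u).1 x = 0 :=
  genericColour_eq_zero d T _ (LabelledGraph.ofLetter_notMem_cover h)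

lemma nodeColour_spec (hc : 1 ≤ c)
    (hA : A.SolvesOnTrees T c (2 * Fintype.card α) (RLe (d - 1))) {u w : V} {x : α × Bool}
    (h : G.step x u = some w) (hinf : (G.cover u).Infinite) :
    (A.nodeColour d T G u).1 x = (A.nodeColour d T G w).1 (invLetter x) ∧
    ((A.nodeColour d T G u).2 → ∑ y, (A.nodeColour d T G u).1 y = 2 ^ (d - 1)) ∧
    ((A.nodeColour d T G u).2 ∨ (A.nodeColour d T G w).2) := by
  have h1 : 1 ∈ seenFrom (G.cover u) (ofLetter x) := by
    rw [LabelledGraph.seenFrom_cover h]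
    exact LabelledGraph.one_mem_cover w
  have hw : A.nodeColour d T G w =
      A.genericColour d T (seenFrom (G.cover u) (ofLetter x)) h1 := by
    unfold nodeColour
    congr 1
    exact (LabelledGraph.seenFrom_cover h).symm
  rw [hw]
  exact genericColour_spec hc hA (LabelledGraph.isRootedSubtree_cover u) hinf
    (LabelledGraph.ofLetter_mem_cover h) h1

/-- The two lifts of a node that are joined by a lift of a loop look alike, so both are saturated. -/
lemma sum_nodeColour_eq (hc : 1 ≤ c)
    (hA : A.SolvesOnTrees T c (2 * Fintype.card α) (RLe (d - 1))) {u : V} {i : α}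
    (h : G.step (i, true) u = some u) : ∑ y, (A.nodeColour d T G u).1 y = 2 ^ (d - 1) := by
  obtain ⟨-, h2, h3⟩ := nodeColour_spec hc hA h (LabelledGraph.infinite_cover h)
  exact h2 (or_self_iff.1 h3)

/-- The value of a bridge is divisible by one more power of two than is known for all values: in the
sum of the values around all nodes on one side of the bridge, the value of every other edge is
counted twice or not at all. -/
lemma two_pow_succ_dvd_of_isCut [Fintype V] [DecidableEq V] (hc : 1 ≤ c)
    (hA : A.SolvesOnTrees T c (2 * Fintype.card α) (RLe (d - 1)))
    (hloop : ∀ u, ∃ i, G.step (i, true) u = some u) {k : ℕ} (hk : k + 1 ≤ d - 1)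
    (hdvd : ∀ u y, 2 ^ k ∣ (A.nodeColour d T G u).1 y) {K : Finset V} {u w : V} {i : α}
    (hstep : G.step (i, true) u = some w) (hK : G.IsCut K u i) :
    2 ^ (k + 1) ∣ (A.nodeColour d T G u).1 (i, true) := by
  set z : V → α × Bool → ZMod (2 ^ d) := fun u => (A.nodeColour d T G u).1 with hz
  change 2 ^ (k + 1) ∣ z u (i, true)
  have hsymm : ∀ p j q, G.step (j, true) p = some q → z p (j, true) = z q (j, false) := by
    intro p j q h
    obtain ⟨l, hl⟩ := hloop p
    exact (nodeColour_spec hc hA h (LabelledGraph.infinite_cover hl)).1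
  have hsum : ∀ p, ∑ y, z p y = 2 ^ (d - 1) := by
    intro p
    obtain ⟨l, hl⟩ := hloop p
    exact sum_nodeColour_eq hc hA hl
  -- the contribution of the edge of label `j` that starts in `p`
  let t : V × α → ZMod (2 ^ d) := fun p =>
    (if p.1 ∈ K then z p.1 (p.2, true) else 0) +
      ∑ q ∈ K, if G.step (p.2, true) p.1 = some q then z p.1 (p.2, true) else 0
  have hin : ∀ q j, z q (j, false) =
      ∑ p, if G.step (j, true) p = some q then z p (j, true) else 0 := by
    intro q j
    rcases hq : G.step (j, false) q with _ | p
    · rw [Finset.sum_eq_zero, hz]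
      · exact nodeColour_eq_zero hq
      · intro p _
        rw [if_neg]
        intro h
        have := G.step_symm h
        simp only [invLetter, Bool.not_true] at this
        rw [this] at hq
        simp at hq
    · have hp : G.step (j, true) p = some q := G.step_symm hq
      rw [Finset.sum_eq_single p, if_pos hp, hsymm p j q hp]
      · intro p' _ hne
        rw [if_neg]
        intro h
        have := G.step_symm h
        simp only [invLetter, Bool.not_true] at this
        rw [this] at hq
        exact hne (Option.some_injective _ hq)
      · simp
  have htotal : ∑ p, t p = ∑ q ∈ K, ∑ y, z q y := by
    have h1 : ∀ q, ∑ y, z q y = ∑ j, z q (j, true) + ∑ j, z q (j, false) := by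
      intro q
      rw [Fintype.sum_prod_type]
      simp only [Fintype.sum_bool, Finset.sum_add_distrib]
    simp only [t, h1, Finset.sum_add_distrib]
    congr 1
    · rw [Fintype.sum_prod_type_right]
      simp only [Finset.sum_ite_mem, Finset.univ_inter]
      exact Finset.sum_comm
    · simp only [hin]
      rw [Finset.sum_comm]
      refine Finset.sum_congr rfl fun q _ => ?_
      rw [Fintype.sum_prod_type_right]
  have hpow : ∀ a : ZMod (2 ^ d), 2 ^ k ∣ a → 2 ^ (k + 1) ∣ a + a := by
    rintro a ⟨b, rfl⟩
    exact ⟨b, by ring⟩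
  have hinner : ∀ p j q, G.step (j, true) p = some q →
      (∑ q' ∈ K, if G.step (j, true) p = some q' then z p (j, true) else 0) =
        if q ∈ K then z p (j, true) else 0 := by
    intro p j q h
    simp only [h, Option.some.injEq]
    rw [Finset.sum_ite_eq]
  have hother : ∀ p ∈ Finset.univ.erase (u, i), 2 ^ (k + 1) ∣ t p := by
    rintro ⟨p, j⟩ hp
    rcases hq : G.step (j, true) p with _ | q
    · have h0 : z p (j, true) = 0 := nodeColour_eq_zero hq
      simp [t, h0]
    · have := hK.closed p j q hq (Finset.ne_of_mem_erase hp)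
      simp only [t]
      rw [hinner p j q hq]
      by_cases hpK : p ∈ K
      · rw [if_pos hpK, if_pos (this.1 hpK)]
        exact hpow _ (hdvd p _)
      · rw [if_neg hpK, if_neg (fun h => hpK (this.2 h)), add_zero]
        exact dvd_zero _
  have hself : t (u, i) = z u (i, true) := by
    have := hK.separates w hstep
    simp only [t]
    rw [hinner u i w hstep]
    by_cases hu : u ∈ K
    · rw [if_pos hu, if_neg (this.1 hu), add_zero]
    · rw [if_neg hu, if_pos (not_not.1 fun h => hu (this.2 h)), zero_add]
  have hall : 2 ^ (k + 1) ∣ ∑ p, t p := by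
    rw [htotal]
    exact Finset.dvd_sum fun q _ => by rw [hsum q]; exact pow_dvd_pow _ hk
  rw [← Finset.add_sum_erase _ _ (Finset.mem_univ (u, i)), hself] at hall
  exact (dvd_add_left (Finset.dvd_sum hother)).1 hall

/-- In a tree-like labelled graph with more than `k` loops at each node, all values are divisible by
`2 ^ k`. In the induction step, a loop is replaced by the middle edge of a long path; this costs one
loop per node but turns the loop into a bridge without changing the surroundings of its ends. -/
lemma two_pow_dvd_nodeColour (hc : 1 ≤ c)
    (hA : A.SolvesOnTrees T c (2 * Fintype.card α) (RLe (d - 1))) (k : ℕ) (hk : k + 1 ≤ d)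
    (V : Type) [Fintype V] [DecidableEq V] (G : LabelledGraph α V) (hG : G.IsTreeLike)
    (hloops : ∀ u, k + 1 ≤ (G.loops u).card) (u : V) (y : α × Bool) :
    2 ^ k ∣ (A.nodeColour d T G u).1 y := by
  classical
  induction k generalizing V y with
  | zero => simp
  | succ k ih =>
    have hloop : ∀ {W : Type} [Fintype W] [DecidableEq W] (H : LabelledGraph α W),
        (∀ u, k + 1 ≤ (H.loops u).card) → ∀ u, ∃ i, H.step (i, true) u = some u := by
      intro W _ _ H hH u
      obtain ⟨i, hi⟩ := Finset.card_pos.1 (Nat.lt_of_lt_of_le (Nat.succ_pos k) (hH u))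
      exact ⟨i, LabelledGraph.mem_loops.1 hi⟩
    have hloopG := hloop G fun u => by have := hloops u; omega
    have hmain : ∀ u i w, G.step (i, true) u = some w →
        2 ^ (k + 1) ∣ (A.nodeColour d T G u).1 (i, true) := by
      intro u i w hw
      by_cases hwu : w = u
      · subst hwu
        let N := 2 * (T + 1) + 1
        let H := G.unfold w i hw N
        let a : Fin N := ⟨T + 1, by omega⟩
        have hH : ∀ p, k + 1 ≤ (H.loops p).card := by
          rintro ⟨p, b⟩
          have h1 := hloops p
          have h2 := LabelledGraph.card_loops_le_unfold (h₀ := hw) p b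
          simp only [H]
          omega
        have hHtree : H.IsTreeLike := LabelledGraph.isTreeLike_unfold hG
        have hcol : A.nodeColour d T G w = A.nodeColour d T H (w, a) :=
          genericColour_congr d T _ _ fun g hg =>
            (LabelledGraph.isSome_walk_unfold g.toWord w a hg (by
              have : g.toWord.length ≤ T + 1 := hg
              simp only [a, N]
              omega)).symm
        have hs : H.step (i, true) (w, a) = some (w, ⟨a.1 + 1, by simp only [a, N]; omega⟩) := by
          simp only [H]
          rw [LabelledGraph.unfold_step_loop, LabelledGraph.pathStep, if_pos rfl,
            dif_pos (by simp only [a, N]; omega)]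
          rfl
        rw [hcol]
        exact two_pow_succ_dvd_of_isCut hc hA (hloop H hH) (by omega)
          (fun p x => ih (by omega) _ H hHtree hH p x) hs (LabelledGraph.isCut_unfold_path a)
      · obtain ⟨K, hK⟩ := hG u i w hw hwu
        exact two_pow_succ_dvd_of_isCut hc hA hloopG (by omega)
          (fun p x => ih (by omega) V G hG (fun u => by have := hloops u; omega) p x) hw hK
    rcases hy : G.step y u with _ | w
    · rw [nodeColour_eq_zero hy]
      exact dvd_zero _
    · obtain ⟨i, b⟩ := y
      cases b
      · have hy' : G.step (i, true) w = some u := G.step_symm hy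
        obtain ⟨l, hl⟩ := hloopG u
        rw [(nodeColour_spec hc hA hy (LabelledGraph.infinite_cover hl)).1]
        exact hmain w i u hy'
      · exact hmain u i w hy

end LocalAlgorithm

/-! ### The bouquet of loops -/

/-- The labelled graph with one node and a loop of each label; its universal cover is the whole
Cayley tree. -/
def LabelledGraph.bouquet (α : Type) : LabelledGraph α Unit where
  step _ _ := some ()
  step_symm _ := rfl

theorem mainTheorem4 (d : ℕ) (hd : 1 ≤ d) (T : ℕ) (c : ℕ) (hc : 1 ≤ c) :
    ¬ ∃ A : LocalAlgorithm.{u, v}, A.SolvesOnTrees T c (2 * d) (RLe (d - 1)) := by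
  rintro ⟨A, hA⟩
  have hA' : A.SolvesOnTrees T c (2 * Fintype.card (Fin d)) (RLe (d - 1)) := by
    rwa [Fintype.card_fin]
  let G := LabelledGraph.bouquet (Fin d)
  have hstep : ∀ i, G.step (i, true) () = some () := fun _ => rfl
  have hdvd : ∀ y, 2 ^ (d - 1) ∣ (A.nodeColour d T G ()).1 y :=
    LocalAlgorithm.two_pow_dvd_nodeColour hc hA' (d - 1) (by omega) Unit G
      (fun _ _ _ _ h => absurd rfl h) (fun u => by
        have : G.loops u = Finset.univ := by
          ext i
          simp [hstep]
        rw [this, Finset.card_univ, Fintype.card_fin]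
        omega) ()
  have hsum := LocalAlgorithm.sum_nodeColour_eq hc hA' (hstep ⟨0, by omega⟩)
  -- both ends of each loop contribute to the sum, so the sum vanishes modulo `2 ^ d`
  have htwo : (2 : ZMod (2 ^ d)) ^ (d - 1) * 2 = 0 := by
    rw [← pow_succ, Nat.sub_add_cancel hd]
    exact_mod_cast ZMod.natCast_self (2 ^ d)
  have hzero : ∑ y, (A.nodeColour d T G ()).1 y = 0 := by
    rw [Fintype.sum_prod_type]
    refine Finset.sum_eq_zero fun i _ => ?_
    have hi : (A.nodeColour d T G ()).1 (i, true) = (A.nodeColour d T G ()).1 (i, false) :=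
      (LocalAlgorithm.nodeColour_spec hc hA' (hstep i)
        (LabelledGraph.infinite_cover (hstep i))).1
    obtain ⟨b, hb⟩ := hdvd (i, false)
    rw [Fintype.sum_bool, hi, hb, ← two_mul, ← mul_assoc, mul_comm 2, htwo, zero_mul]
  rw [hzero] at hsum
  have h2 : ((2 ^ (d - 1) : ℕ) : ZMod (2 ^ d)) = 0 := by
    push_cast
    exact hsum.symm
  rw [ZMod.natCast_eq_zero_iff] at h2
  have := (Nat.pow_dvd_pow_iff_le_right (by norm_num : 1 < 2)).1 h2
  omega
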